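/- Let $d\ge 3$ and let $\hat H_0$ be the bounded operator on $\ell^2(\mathbf Z^d)$ given by $$(\hat H_0\hat f)(n)=\frac d2\hat f(n)-\frac14\sum_{j=1}^d\big\{\hat f(n+e_j)+\hat f(n-e_j)\big\},$$ where $e_1,\dots,e_d$ is the standard basis of $\mathbf Z^d$. For every $\lambda\in\mathbf C\setminus[0,d]$ the operator $\hat H_0-\lambda$ is invertible; put $\hat R_0(\lambda)=(\hat H_0-\lambda)^{-1}$. For $r\in\mathbf R$ and $k\ge1$ let $\hat\rho_r(m)=(1+|m|^2)^{-r/2}$, $m\in\mathbf Z^k$, with $|m|$ the Euclidean length. Let $0<s\le 1$. For $\hat q_1,\hat q_2\in\ell^2(\mathbf Z)$ and $r>0$ put $$\hat Q_r(n)=\hat q_1(n_1)\,\hat q_2(n_2)\,\hat\rho_r(n'),\qquad n=(n_1,\dots,n_d)\in\mathbf Z^d,\quad n'=(n_3,\dots,n_d)\in\mathbf Z^{d-2},$$ and denote multiplication operators on $\ell^2(\mathbf Z^d)$ by the same symbol as the functions. All norms of operators are operator norms on $\ell^2(\mathbf Z^d)$. (1) There is a constant $C_s>0$, depending only on $d$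 and $s$, such that for all $\hat q_1,\hat q_2\in\ell^2(\mathbf Z)$ and all $\lambda\in\mathbf C\setminus[0,d]$ with $|\lambda|<2d$, $$\|\hat Q_s\hat R_0(\lambda)\hat Q_s\|\le C_s\,\|\hat q_1\|_{\ell^2(\mathbf Z)}^2\,\|\hat q_2\|_{\ell^2(\mathbf Z)}^2 .$$ (2) There is $g_0>0$, depending only on $d$ and $s$, such that for every $g$ with $0<g<g_0$ there is a constant $C_{s,g}>0$, depending only on $d$, $s$ and $g$, with the following property. For $\hat q_1,\hat q_2\in\ell^2(\mathbf Z)$ put $\hat Q_{s,g}(n)=\hat\rho_g(n_1)\,\hat Q_{s+2g}(n)$, $n\in\mathbf Z^d$. Then for all $\lambda,\lambda_1$ with $|\lambda|<2d$, $|\lambda_1|<2d$ that lie both in the open upper half-plane or both in the open lower half-plane, $$\big\|\hat Q_{s,g}\,(\hat R_0(\lambda)-\hat R_0(\lambda_1))\,\hat Q_{s,g}\big\|\le |\lambda-\lambda_1|^{g}\,C_{s,g}\,\|\hat q_1\|_{\ell^2(\mathbf Z)}^2\,\|\hat q_2\|_{\ell^2(\mathbf Z)}^2 .$$ -/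

import Mathlib

open scoped ENNReal

namespace FreeLattice

/-- `ℓ²(ℤ)`. -/
abbrev L2Z : Type := lp (fun _ : ℤ => ℂ) 2

/-- `ℓ²(ℤᵈ)`. -/
abbrev L2Zd (d : ℕ) : Type := lp (fun _ : Fin d → ℤ => ℂ) 2

theorem memℓp_shift {d : ℕ} (e : Fin d → ℤ) (f : L2Zd d) :
    Memℓp (fun n => f (n + e)) 2 := by
  have h := (memℓp_gen_iff (p := 2) (by norm_num)).1 (lp.memℓp f)
  exact memℓp_gen (h.comp_injective (Equiv.addRight e).injective)

/-- The translation `(T_e f)(n) = f (n + e)` on `ℓ²(ℤᵈ)`, as a linear isometry. -/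
noncomputable def shiftIsom {d : ℕ} (e : Fin d → ℤ) : L2Zd d →ₗᵢ[ℂ] L2Zd d where
  toFun f := ⟨fun n => f (n + e), memℓp_shift e f⟩
  map_add' f g := by ext n; rfl
  map_smul' c f := by ext n; rfl
  norm_map' f := by
    rw [lp.norm_eq_tsum_rpow (by norm_num), lp.norm_eq_tsum_rpow (by norm_num)]
    congr 1
    exact (Equiv.addRight e).tsum_eq (fun n => ‖f n‖ ^ (2 : ℝ≥0∞).toReal)

/-- The translation `(T_e f)(n) = f (n + e)` as a bounded operator. -/
noncomputable def shift {d : ℕ} (e : Fin d → ℤ) : L2Zd d →L[ℂ] L2Zd d :=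
  (shiftIsom e).toContinuousLinearMap

/-- The free discrete Schrödinger operator
`(H₀ f)(n) = (d/2) f(n) - (1/4) ∑ⱼ (f(n + eⱼ) + f(n - eⱼ))` on `ℓ²(ℤᵈ)`. -/
noncomputable def H0 (d : ℕ) : L2Zd d →L[ℂ] L2Zd d :=
  ((d : ℂ) / 2) • ContinuousLinearMap.id ℂ (L2Zd d)
    - (1 / 4 : ℂ) • ∑ j : Fin d, (shift (Pi.single j 1) + shift (-Pi.single j 1))

theorem H0_apply {d : ℕ} (f : L2Zd d) (n : Fin d → ℤ) :
    H0 d f n = (d : ℂ) / 2 * f n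
      - 1 / 4 * ∑ j : Fin d, (f (n + Pi.single j 1) + f (n - Pi.single j 1)) := by
  have h1 : H0 d f = ((d : ℂ) / 2) • f
      - (1 / 4 : ℂ) • ∑ j : Fin d, (shift (Pi.single j 1) f + shift (-Pi.single j 1) f) := by
    simp [H0]
  rw [h1, lp.coeFn_sub, lp.coeFn_smul, lp.coeFn_smul, lp.coeFn_sum, Pi.sub_apply, Pi.smul_apply,
    Pi.smul_apply, Finset.sum_apply, smul_eq_mul, smul_eq_mul]
  rfl

/-- The free resolvent `R₀(z) = (H₀ - z)⁻¹`; it is the two-sided inverse when `H₀ - z` is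
invertible, and `0` otherwise. -/
noncomputable def R0 (d : ℕ) (z : ℂ) : L2Zd d →L[ℂ] L2Zd d :=
  Ring.inverse (H0 d - z • ContinuousLinearMap.id ℂ (L2Zd d))

/-- The set `Λ_d = ℂ ∖ [0, d]`. -/
def Lam (d : ℕ) : Set ℂ := ((fun x : ℝ => (x : ℂ)) '' Set.Icc (0 : ℝ) d)ᶜ

/-- Multiplication by a bounded function: `(q f)(n) = q(n) f(n)` on `ℓ²(ℤᵈ)`. -/
noncomputable def mulOp {d : ℕ} (q : lp (fun _ : Fin d → ℤ => ℂ) ∞) : L2Zd d →L[ℂ] L2Zd d :=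
  lp.mapCLM 2 (fun n => ContinuousLinearMap.mul ℂ ℂ (q n)) (norm_nonneg q)
    (fun n => by simpa using lp.norm_apply_le_norm ENNReal.top_ne_zero q n)

theorem mulOp_apply {d : ℕ} (q : lp (fun _ : Fin d → ℤ => ℂ) ∞) (f : L2Zd d)
    (n : Fin d → ℤ) : mulOp q f n = q n * f n := rfl

/-- The weight `ρ_s(n) = (1 + |n|²)^(-s/2)` on `ℤᵏ`, with `|n|` the Euclidean length. -/
noncomputable def rho (s : ℝ) {k : ℕ} (n : Fin k → ℤ) : ℝ :=
  (1 + ∑ j, (n j : ℝ) ^ 2) ^ (-s / 2)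

theorem rho_nonneg (s : ℝ) {k : ℕ} (n : Fin k → ℤ) : 0 ≤ rho s n :=
  Real.rpow_nonneg (by positivity) _

theorem rho_le_one {s : ℝ} (hs : 0 ≤ s) {k : ℕ} (n : Fin k → ℤ) : rho s n ≤ 1 :=
  Real.rpow_le_one_of_one_le_of_nonpos
    (le_add_of_nonneg_right (by positivity)) (by linarith)

/-- `Q_s(n) = q₁(n₁) q₂(n₂) ρ_s(n')`, where `n' = (n₃, …, n_d)`. -/
noncomputable def Qfun {d : ℕ} (hd : 3 ≤ d) (s : ℝ) (q₁ q₂ : L2Z) (n : Fin d → ℤ) : ℂ :=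
  q₁ (n ⟨0, by omega⟩) * q₂ (n ⟨1, by omega⟩)
    * (rho s (fun j : Fin (d - 2) => n ⟨j + 2, by omega⟩) : ℂ)

/-- `Q_{s,g}(n) = ρ_g(n₁) Q_{s+2g}(n)`. -/
noncomputable def Qgfun {d : ℕ} (hd : 3 ≤ d) (s g : ℝ) (q₁ q₂ : L2Z) (n : Fin d → ℤ) : ℂ :=
  (rho g (fun _ : Fin 1 => n ⟨0, by omega⟩) : ℂ) * Qfun hd (s + 2 * g) q₁ q₂ n

theorem norm_Qfun_le {d : ℕ} (hd : 3 ≤ d) {s : ℝ} (hs : 0 ≤ s) (q₁ q₂ : L2Z)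
    (n : Fin d → ℤ) : ‖Qfun hd s q₁ q₂ n‖ ≤ ‖q₁‖ * ‖q₂‖ := by
  have h1 := lp.norm_apply_le_norm two_ne_zero q₁ (n ⟨0, by omega⟩)
  have h2 := lp.norm_apply_le_norm two_ne_zero q₂ (n ⟨1, by omega⟩)
  have h3 := rho_le_one hs (fun j : Fin (d - 2) => n ⟨j + 2, by omega⟩)
  have h4 := rho_nonneg s (fun j : Fin (d - 2) => n ⟨j + 2, by omega⟩)
  rw [Qfun, norm_mul, norm_mul, Complex.norm_real, Real.norm_of_nonneg h4]
  exact (mul_le_of_le_one_right (by positivity) h3).trans (by gcongr)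

theorem norm_Qgfun_le {d : ℕ} (hd : 3 ≤ d) {s g : ℝ} (hs : 0 ≤ s) (hg : 0 ≤ g) (q₁ q₂ : L2Z)
    (n : Fin d → ℤ) : ‖Qgfun hd s g q₁ q₂ n‖ ≤ ‖q₁‖ * ‖q₂‖ := by
  have h1 := norm_Qfun_le hd (show 0 ≤ s + 2 * g by linarith) q₁ q₂ n
  have h3 := rho_le_one hg (fun _ : Fin 1 => n ⟨0, by omega⟩)
  have h4 := rho_nonneg g (fun _ : Fin 1 => n ⟨0, by omega⟩)
  rw [Qgfun, norm_mul, Complex.norm_real, Real.norm_of_nonneg h4]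
  exact (mul_le_of_le_one_left (norm_nonneg _) h3).trans h1

/-- The operator of multiplication by `Q_s` on `ℓ²(ℤᵈ)`. -/
noncomputable def Q {d : ℕ} (hd : 3 ≤ d) {s : ℝ} (hs : 0 ≤ s) (q₁ q₂ : L2Z) :
    L2Zd d →L[ℂ] L2Zd d :=
  mulOp ⟨Qfun hd s q₁ q₂, memℓp_infty
    ⟨‖q₁‖ * ‖q₂‖, Set.forall_mem_range.2 (norm_Qfun_le hd hs q₁ q₂)⟩⟩

/-- The operator of multiplication by `Q_{s,g}` on `ℓ²(ℤᵈ)`. -/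
noncomputable def Qg {d : ℕ} (hd : 3 ≤ d) {s g : ℝ} (hs : 0 ≤ s) (hg : 0 ≤ g) (q₁ q₂ : L2Z) :
    L2Zd d →L[ℂ] L2Zd d :=
  mulOp ⟨Qgfun hd s g q₁ q₂, memℓp_infty
    ⟨‖q₁‖ * ‖q₂‖, Set.forall_mem_range.2 (norm_Qgfun_le hd hs hg q₁ q₂)⟩⟩

end FreeLattice

open FreeLattice

/-! For `Im z > 0` the resolvent is `i ∫₀^∞ exp(itz) exp(-itH₀) dt`, and for `Im z < 0` the same
holds with time reversed. It is therefore enough to bound the weighted propagator by a function of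
time that is integrable, uniformly in `z`. Since `H₀` is a sum of commuting one-dimensional
operators, the propagator is a product of one-dimensional ones, whose matrix entries have modulus
`‖bes (k - l) t‖`, that is `|J_{k-l}(t/2)|`.

Restrict the first two coordinates to single slices on either side. The block then has norm at most
`‖bes (k₁ - l₁) t‖ * ‖bes (k₂ - l₂) t‖` times the weighted propagator of the third coordinate
(`norm_block_prop_le`); the other coordinates contribute a contraction. The product of the Bessel
factors only just fails to be integrable: `∫₀ᵀ ‖bes a t‖²` is `O(T^e)` for every `e > 0`, uniformly
in `a` (`exists_integral_norm_sq_bes_le`). The weight in the third coordinate yields decay `(1 +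
|t|)^(-s/32)` (`exists_norm_weight_prop_weight_le`), which closes this gap. A bound common to all
blocks becomes, by Cauchy–Schwarz over the slices, an operator bound with the factors `‖q₁‖²` and
`‖q₂‖²` (`norm_coordMul_mul_mul_le`).

For the Hölder estimate, `|exp(itz) - exp(itz₁)| ≤ 2 |z - z₁|^g t^g`, and half of the decay in the
third coordinate absorbs `t^g`; hence `g₀ = s / 64`. Real `z` off `[0, d]` are reached by continuity
of the resolvent. -/

namespace FreeLattice

/-! ### Multiplication operators and slice projections. -/

/-- Bounded operators on `ℓ²(ℤᵈ)`. -/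
abbrev Op (d : ℕ) : Type := L2Zd d →L[ℂ] L2Zd d

open Classical in
/-- Multiplication by the function `w` if it is bounded, and `0` otherwise. -/
noncomputable def mulBdd {d : ℕ} (w : (Fin d → ℤ) → ℂ) : Op d :=
  if h : Memℓp w ∞ then mulOp ⟨w, h⟩ else 0

theorem memℓp_infty_of_le {ι : Type*} {w : ι → ℂ} {K : ℝ} (h : ∀ n, ‖w n‖ ≤ K) : Memℓp w ∞ :=
  memℓp_infty ⟨K, Set.forall_mem_range.2 h⟩

theorem mulOp_eq_mulBdd {d : ℕ} (w : (Fin d → ℤ) → ℂ) (h : Memℓp w ∞) :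
    mulOp ⟨w, h⟩ = mulBdd w := by
  rw [mulBdd, dif_pos h]

theorem mulBdd_apply {d : ℕ} {w : (Fin d → ℤ) → ℂ} {K : ℝ} (h : ∀ n, ‖w n‖ ≤ K) (f : L2Zd d)
    (n : Fin d → ℤ) : mulBdd w f n = w n * f n := by
  rw [mulBdd, dif_pos (memℓp_infty_of_le h)]
  rfl

theorem norm_mulBdd_le {d : ℕ} {w : (Fin d → ℤ) → ℂ} {K : ℝ} (h : ∀ n, ‖w n‖ ≤ K) :
    ‖mulBdd w‖ ≤ K := by
  have hK : 0 ≤ K := (norm_nonneg _).trans (h 0)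
  refine ContinuousLinearMap.opNorm_le_bound _ hK fun f => ?_
  have h1 : ‖mulBdd w f‖ ≤ ‖((K : ℂ) • f)‖ := by
    refine lp.norm_mono two_ne_zero fun n => ?_
    rw [mulBdd_apply h, lp.coeFn_smul, Pi.smul_apply, norm_mul, norm_smul, Complex.norm_real,
      Real.norm_of_nonneg hK]
    exact mul_le_mul_of_nonneg_right (h n) (norm_nonneg _)
  rwa [norm_smul, Complex.norm_real, Real.norm_of_nonneg hK] at h1

theorem Op.mul_apply {d : ℕ} (A B : Op d) (f : L2Zd d) : (A * B) f = A (B f) := rfl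

theorem Op.smul_apply {d : ℕ} (c : ℂ) (A : Op d) (f : L2Zd d) (n : Fin d → ℤ) :
    (c • A) f n = c * A f n := rfl

theorem Op.ext {d : ℕ} {A B : Op d} (h : ∀ f n, A f n = B f n) : A = B :=
  ContinuousLinearMap.ext fun f => lp.ext (funext fun n => h f n)

theorem mulBdd_mul {d : ℕ} {v w : (Fin d → ℤ) → ℂ} {K L : ℝ} (hv : ∀ n, ‖v n‖ ≤ K)
    (hw : ∀ n, ‖w n‖ ≤ L) : mulBdd v * mulBdd w = mulBdd (fun n => v n * w n) := by
  have h : ∀ n, ‖v n * w n‖ ≤ K * L := fun n => by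
    rw [norm_mul]
    exact mul_le_mul (hv n) (hw n) (norm_nonneg _) ((norm_nonneg _).trans (hv n))
  refine Op.ext fun f n => ?_
  rw [mulBdd_apply h, Op.mul_apply, mulBdd_apply hv, mulBdd_apply hw, mul_assoc]

theorem commute_mulBdd {d : ℕ} {v w : (Fin d → ℤ) → ℂ} {K L : ℝ} (hv : ∀ n, ‖v n‖ ≤ K)
    (hw : ∀ n, ‖w n‖ ≤ L) : Commute (mulBdd v) (mulBdd w) := by
  rw [Commute, SemiconjBy, mulBdd_mul hv hw, mulBdd_mul hw hv]
  simp_rw [mul_comm]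

/-- Multiplication by a function of the `j`-th coordinate. -/
noncomputable def coordMul {d : ℕ} (j : Fin d) (u : ℤ → ℂ) : Op d := mulBdd fun n => u (n j)

theorem coordMul_apply {d : ℕ} (j : Fin d) {u : ℤ → ℂ} {K : ℝ} (h : ∀ k, ‖u k‖ ≤ K)
    (f : L2Zd d) (n : Fin d → ℤ) : coordMul j u f n = u (n j) * f n :=
  mulBdd_apply (fun n => h (n j)) f n

theorem norm_coordMul_le {d : ℕ} (j : Fin d) {u : ℤ → ℂ} {K : ℝ} (h : ∀ k, ‖u k‖ ≤ K) :
    ‖coordMul j u‖ ≤ K := norm_mulBdd_le fun n => h (n j)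

/-- The indicator function of `{k}`. -/
def ind (k : ℤ) (m : ℤ) : ℂ := if m = k then 1 else 0

theorem norm_ind_le (k m : ℤ) : ‖ind k m‖ ≤ 1 := by
  unfold ind; split_ifs <;> simp

/-- The projection onto the slice `{n | n j = k}`. -/
noncomputable def proj {d : ℕ} (j : Fin d) (k : ℤ) : Op d := coordMul j (ind k)

theorem proj_apply {d : ℕ} (j : Fin d) (k : ℤ) (f : L2Zd d) (n : Fin d → ℤ) :
    proj j k f n = if n j = k then f n else 0 := by
  rw [proj, coordMul_apply j (norm_ind_le k), ind]
  split_ifs <;> simp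

theorem norm_proj_le {d : ℕ} (j : Fin d) (k : ℤ) : ‖proj j k‖ ≤ 1 :=
  norm_coordMul_le j (norm_ind_le k)

theorem proj_mul_proj {d : ℕ} (j : Fin d) (k l : ℤ) :
    proj j k * proj j l = if k = l then proj j l else 0 := by
  refine Op.ext fun f n => ?_
  rw [Op.mul_apply, proj_apply, proj_apply]
  by_cases h : k = l
  · subst h
    simp only [if_true, proj_apply]
    split_ifs <;> rfl
  · rw [if_neg h]
    split_ifs with h1 h2
    · exact absurd (h1.symm.trans h2) h
    · rfl
    · rfl

theorem proj_mul_self {d : ℕ} (j : Fin d) (k : ℤ) : proj j k * proj j k = proj j k := by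
  rw [proj_mul_proj, if_pos rfl]

theorem hasSum_norm_sq {ι : Type*} (f : lp (fun _ : ι => ℂ) 2) :
    HasSum (fun n => ‖f n‖ ^ 2) (‖f‖ ^ 2) := by
  simpa using lp.hasSum_norm (p := 2) (by norm_num) f

/-- Pythagoras: the slices `{n | n j = k}` partition the lattice. -/
theorem hasSum_norm_proj_sq {d : ℕ} (j : Fin d) (f : L2Zd d) :
    HasSum (fun k => ‖proj j k f‖ ^ 2) (‖f‖ ^ 2) := by
  have h : (fun k => ‖proj j k f‖ ^ 2)
      = fun k => ∑' n : (fun n : Fin d → ℤ => n j) ⁻¹' {k}, ‖f n‖ ^ 2 := by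
    funext k
    rw [← (hasSum_norm_sq _).tsum_eq, tsum_subtype _ (fun n => ‖f n‖ ^ 2)]
    refine tsum_congr fun n => ?_
    rw [proj_apply]
    by_cases hn : n j = k
    · rw [if_pos hn, Set.indicator_of_mem (s := (fun n : Fin d → ℤ => n j) ⁻¹' {k}) hn]
    · rw [if_neg hn, Set.indicator_of_notMem (s := (fun n : Fin d → ℤ => n j) ⁻¹' {k}) hn,
        norm_zero, sq, zero_mul]
  rw [h]
  exact (hasSum_norm_sq f).tsum_fiberwise (fun n => n j)

theorem coordMul_mul_proj {d : ℕ} (j : Fin d) {u : ℤ → ℂ} {K : ℝ} (h : ∀ k, ‖u k‖ ≤ K) (k : ℤ) :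
    proj j k * coordMul j u = u k • proj j k := by
  refine Op.ext fun f n => ?_
  rw [Op.mul_apply, proj_apply, coordMul_apply j h, Op.smul_apply,
    proj_apply]
  split_ifs with h1
  · rw [h1]
  · simp

theorem norm_coe_le (q : L2Z) (k : ℤ) : ‖q k‖ ≤ ‖q‖ := lp.norm_apply_le_norm two_ne_zero q k

theorem hasSum_coe_apply {d : ℕ} {ι : Type*} {F : ι → L2Zd d} {a : L2Zd d} (h : HasSum F a)
    (n : Fin d → ℤ) : HasSum (fun k => F k n) (a n) :=
  (lp.evalCLM ℂ (fun _ : Fin d → ℤ => ℂ) 2 n).hasSum h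

/-- Square-summability of `q` and of the slice norms gives absolute convergence by Cauchy–Schwarz;
the limit is then identified pointwise, where only the term `k = n j` survives. -/
theorem hasSum_smul_proj {d : ℕ} (j : Fin d) (q : L2Z) (g : L2Zd d) :
    Summable (fun k => ‖q k‖ * ‖proj j k g‖) ∧ ∑' k, ‖q k‖ * ‖proj j k g‖ ≤ ‖q‖ * ‖g‖ ∧
    HasSum (fun k => q k • proj j k g) (coordMul j q g) := by
  have h1 := hasSum_norm_sq q
  have h2 := hasSum_norm_proj_sq j g
  have hc := Real.summable_and_inner_le_Lp_mul_Lq_tsum_of_nonneg (f := fun k => ‖q k‖)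
    (g := fun k => ‖proj j k g‖) (p := 2) (q := 2)
    Real.HolderConjugate.two_two
    (fun _ => norm_nonneg _) (fun _ => norm_nonneg _) (by simpa using h1.summable)
    (by simpa using h2.summable)
  have hs : Summable (fun k => q k • proj j k g) :=
    Summable.of_norm (by simpa only [norm_smul] using hc.1)
  refine ⟨hc.1, ?_, ?_⟩
  · refine hc.2.trans_eq ?_
    have e1 : ∑' k, ‖q k‖ ^ (2 : ℝ) = ‖q‖ ^ (2 : ℝ) := by simpa using h1.tsum_eq
    have e2 : ∑' k, ‖proj j k g‖ ^ (2 : ℝ) = ‖g‖ ^ (2 : ℝ) := by simpa using h2.tsum_eq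
    rw [e1, e2, ← Real.rpow_mul (norm_nonneg _), ← Real.rpow_mul (norm_nonneg _)]
    norm_num
  · convert hs.hasSum
    refine lp.ext (funext fun n => ?_)
    have h3 := hasSum_coe_apply hs.hasSum n
    rw [coordMul_apply j (norm_coe_le q)]
    refine (HasSum.unique h3 ?_).symm
    convert hasSum_single (n j) ?_ using 1
    · simp [proj_apply]
    · intro k hk
      simp [proj_apply, hk.symm]

/-- If all the blocks `P_k Y P_l` are bounded by `C`, then `q Y q` is bounded by `C ‖q‖²`. -/
theorem norm_coordMul_mul_mul_le {d : ℕ} (j : Fin d) (q : L2Z) (Y : Op d) {C : ℝ}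
    (hY : ∀ k l, ‖proj j k * Y * proj j l‖ ≤ C) :
    ‖coordMul j q * Y * coordMul j q‖ ≤ C * ‖q‖ ^ 2 := by
  have hC : 0 ≤ C := (norm_nonneg _).trans (hY 0 0)
  refine ContinuousLinearMap.opNorm_le_bound _ (by positivity) fun g => ?_
  obtain ⟨hs, hle, hsum⟩ := hasSum_smul_proj j q g
  -- The right factor `q` is summed by Cauchy–Schwarz, uniformly in the output slice `k`;
  -- idempotence of `proj j l` turns each term into a block.
  have key : ∀ k, ‖proj j k (Y (coordMul j q g))‖ ≤ C * (‖q‖ * ‖g‖) := fun k => by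
    have h1 := (proj j k * Y).hasSum hsum
    have h2 : ∀ l, ‖(proj j k * Y) (q l • proj j l g)‖ ≤ C * (‖q l‖ * ‖proj j l g‖) := fun l => by
      have h3 : (proj j k * Y) (proj j l g) = (proj j k * Y * proj j l) (proj j l g) := by
        conv_lhs => rw [← proj_mul_self j l]
        rfl
      rw [map_smul, norm_smul, h3]
      calc _ ≤ ‖q l‖ * (C * ‖proj j l g‖) := by
            gcongr
            exact ContinuousLinearMap.le_of_opNorm_le _ (hY k l) _
        _ = _ := by ring
    have h4 := tsum_of_norm_bounded (hs.hasSum.mul_left C) h2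
    rw [h1.tsum_eq] at h4
    exact h4.trans (by gcongr)
  -- The left factor `q` is summed by Pythagoras: the output slice `k` carries the scalar `q k`.
  have h5 : ‖(coordMul j q * Y * coordMul j q) g‖ ^ 2 ≤ (C * (‖q‖ * ‖g‖)) ^ 2 * ‖q‖ ^ 2 := by
    rw [← (hasSum_norm_proj_sq j _).tsum_eq, ← ((hasSum_norm_sq q).mul_left _).tsum_eq]
    refine (hasSum_norm_proj_sq j _).summable.tsum_le_tsum (fun k => ?_)
      ((hasSum_norm_sq q).mul_left _).summable
    have h6 : proj j k ((coordMul j q * Y * coordMul j q) g)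
        = q k • proj j k (Y (coordMul j q g)) := by
      have := congrArg (fun A => A (Y (coordMul j q g))) (coordMul_mul_proj j (norm_coe_le q) k)
      exact this
    rw [h6, norm_smul, mul_pow, mul_comm]
    gcongr
    exact key k
  have h7 : ‖(coordMul j q * Y * coordMul j q) g‖ ^ 2 ≤ (C * ‖q‖ ^ 2 * ‖g‖) ^ 2 := by
    refine h5.trans_eq (by ring)
  exact le_of_sq_le_sq h7 (by positivity)

theorem hasSum_of_eq {E : Type*} [AddCommMonoid E] [TopologicalSpace E] {f g : ℕ → E} {a : E}
    (h : HasSum f a) (e : ∀ m, f m = g m) : HasSum g a := funext e ▸ h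

/-! ### Shifts, the one-dimensional operators and their propagators. -/

theorem shift_apply {d : ℕ} (e : Fin d → ℤ) (f : L2Zd d) (n : Fin d → ℤ) :
    shift e f n = f (n + e) := rfl

theorem norm_shift_le {d : ℕ} (e : Fin d → ℤ) : ‖shift e‖ ≤ 1 :=
  (shiftIsom e).norm_toContinuousLinearMap_le

theorem shift_mul_shift {d : ℕ} (e e' : Fin d → ℤ) : shift e * shift e' = shift (e + e') :=
  Op.ext fun f n => by rw [Op.mul_apply, shift_apply, shift_apply, shift_apply, add_assoc]

theorem shift_zero {d : ℕ} : shift (0 : Fin d → ℤ) = 1 :=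
  Op.ext fun f n => by rw [shift_apply, add_zero]; rfl

theorem commute_shift {d : ℕ} (e e' : Fin d → ℤ) : Commute (shift e) (shift e') := by
  rw [Commute, SemiconjBy, shift_mul_shift, shift_mul_shift, add_comm]

theorem star_shift {d : ℕ} (e : Fin d → ℤ) : star (shift e) = shift (-e) := by
  rw [ContinuousLinearMap.star_eq_adjoint]
  refine ((ContinuousLinearMap.eq_adjoint_iff _ _).2 fun f g => ?_).symm
  rw [lp.inner_eq_tsum, lp.inner_eq_tsum, ← (Equiv.addRight e).tsum_eq]
  refine tsum_congr fun n => ?_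
  simp [shift_apply]

/-- The one-dimensional free operator acting on the `j`-th coordinate. -/
noncomputable def h0 {d : ℕ} (j : Fin d) : Op d :=
  (1 / 2 : ℂ) • 1 - (1 / 4 : ℂ) • (shift (Pi.single j 1) + shift (-Pi.single j 1))

theorem H0_eq_sum (d : ℕ) : H0 d = ∑ j, h0 j := by
  simp only [h0, Finset.sum_sub_distrib, Finset.sum_const, ← Finset.smul_sum, H0]
  congr 1
  rw [Finset.card_univ, Fintype.card_fin, ← Nat.cast_smul_eq_nsmul ℂ, smul_smul]
  congr 1
  ring

theorem isSelfAdjoint_h0 {d : ℕ} (j : Fin d) : IsSelfAdjoint (h0 j) := by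
  rw [isSelfAdjoint_iff, h0, star_sub, star_smul, star_smul, star_add, star_shift, star_shift,
    neg_neg, star_one, add_comm (shift _)]
  simp

theorem commute_h0 {d : ℕ} (i j : Fin d) : Commute (h0 i) (h0 j) := by
  unfold h0
  refine ((Commute.one_left _).smul_left _).sub_left (Commute.smul_left ?_ _)
  refine ((Commute.one_right _).smul_right _).sub_right (Commute.smul_right ?_ _)
  refine Commute.add_left (Commute.add_right ?_ ?_) (Commute.add_right ?_ ?_) <;>
    exact commute_shift _ _

theorem commute_coordMul_shift {d : ℕ} {i : Fin d} {u : ℤ → ℂ} {K : ℝ} (h : ∀ k, ‖u k‖ ≤ K)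
    {e : Fin d → ℤ} (he : e i = 0) : Commute (coordMul i u) (shift e) :=
  Op.ext fun f n => by
    rw [Op.mul_apply, Op.mul_apply, shift_apply, coordMul_apply i h, coordMul_apply i h,
      shift_apply, Pi.add_apply, he, add_zero]

theorem commute_coordMul_h0 {d : ℕ} {i j : Fin d} (hij : i ≠ j) {u : ℤ → ℂ} {K : ℝ}
    (h : ∀ k, ‖u k‖ ≤ K) : Commute (coordMul i u) (h0 j) := by
  unfold h0
  refine ((Commute.one_right _).smul_right _).sub_right (Commute.smul_right ?_ _)
  exact (commute_coordMul_shift h (by simp [hij])).add_right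
    (commute_coordMul_shift h (by simp [hij]))

theorem commute_coordMul {d : ℕ} (i j : Fin d) {u v : ℤ → ℂ} {K L : ℝ}
    (hu : ∀ k, ‖u k‖ ≤ K) (hv : ∀ k, ‖v k‖ ≤ L) : Commute (coordMul i u) (coordMul j v) :=
  commute_mulBdd (fun n => hu (n i)) (fun n => hv (n j))

/-- The propagator `exp (-itA)`. -/
noncomputable def prop {d : ℕ} (A : Op d) (t : ℝ) : Op d :=
  NormedSpace.exp ((-(t : ℂ) * Complex.I) • A)

theorem prop_add {d : ℕ} {A B : Op d} (h : Commute A B) (t : ℝ) :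
    prop (A + B) t = prop A t * prop B t := by
  let _ : NormedAlgebra ℚ (Op d) := NormedAlgebra.restrictScalars ℚ ℂ (Op d)
  rw [prop, smul_add]
  exact NormedSpace.exp_add_of_commute ((h.smul_left _).smul_right _)

theorem commute_prop {d : ℕ} {A B : Op d} (h : Commute A B) (t : ℝ) : Commute A (prop B t) :=
  (h.smul_right _).exp_right

theorem norm_prop_le {d : ℕ} {A : Op d} (h : IsSelfAdjoint A) (t : ℝ) : ‖prop A t‖ ≤ 1 := by
  let _ : NormedAlgebra ℚ (Op d) := NormedAlgebra.restrictScalars ℚ ℂ (Op d)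
  have hU : prop A t ∈ unitary (Op d) := by
    refine NormedSpace.exp_mem_unitary_of_mem_skewAdjoint ?_
    rw [skewAdjoint.mem_iff, star_smul, h.star_eq]
    simp
  have h1 := CStarRing.norm_star_mul_self (x := prop A t)
  rw [Unitary.star_mul_self_of_mem hU] at h1
  have h2 : ‖(1 : Op d)‖ ≤ 1 := ContinuousLinearMap.norm_id_le
  nlinarith [norm_nonneg (prop A t)]

/-! ### Matrix entries of the one-dimensional propagator. -/

theorem shift_mul_proj_eq {d : ℕ} (j : Fin d) (k a : ℤ) :
    proj j k * shift (Pi.single j a) = shift (Pi.single j a) * proj j (k + a) := by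
  refine Op.ext fun f n => ?_
  rw [Op.mul_apply, Op.mul_apply, shift_apply, proj_apply, proj_apply, shift_apply]
  simp

/-- The `a`-th Fourier coefficient of `(2 cos θ) ^ m`. -/
noncomputable def cosCoeff (m : ℕ) (a : ℤ) : ℂ :=
  (2 * Real.pi : ℂ)⁻¹ * ∫ θ in (0 : ℝ)..2 * Real.pi,
    ((2 * Real.cos θ : ℝ) : ℂ) ^ m * Complex.exp (-(a * θ * Complex.I))

theorem cosCoeff_zero (a : ℤ) : cosCoeff 0 a = if a = 0 then 1 else 0 := by
  have hpi : (2 * Real.pi : ℂ) ≠ 0 := by simp [Real.pi_ne_zero]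
  simp only [cosCoeff, pow_zero, one_mul]
  split_ifs with h
  · subst h
    simp only [Int.cast_zero, zero_mul, neg_zero, Complex.exp_zero]
    rw [intervalIntegral.integral_const, sub_zero, Complex.real_smul, mul_one]
    push_cast
    exact inv_mul_cancel₀ hpi
  · have hc : (-(a * Complex.I) : ℂ) ≠ 0 := by simp [h]
    have h1 : ∀ θ : ℝ, Complex.exp (-(a * θ * Complex.I)) = Complex.exp (-(a * Complex.I) * θ) :=
      fun θ => by ring_nf
    simp_rw [h1]
    rw [integral_exp_mul_complex hc]
    have h2 : Complex.exp (-(a * Complex.I) * (2 * Real.pi : ℝ)) = 1 := by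
      rw [← Complex.exp_int_mul_two_pi_mul_I (-a)]
      congr 1
      push_cast
      ring
    rw [h2]
    simp

/-- From `2 cos θ = exp(iθ) + exp(-iθ)`; the same recurrence arises when one neighbour hop is split
off a power of the hopping operator. -/
theorem cosCoeff_succ (m : ℕ) (a : ℤ) :
    cosCoeff (m + 1) a = cosCoeff m (a + 1) + cosCoeff m (a - 1) := by
  have hc : ∀ b : ℤ, IntervalIntegrable (fun θ : ℝ =>
      ((2 * Real.cos θ : ℝ) : ℂ) ^ m * Complex.exp (-(b * θ * Complex.I)))
      MeasureTheory.volume 0 (2 * Real.pi) := fun b =>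
    Continuous.intervalIntegrable (by fun_prop) _ _
  rw [cosCoeff, cosCoeff, cosCoeff, ← mul_add, ← intervalIntegral.integral_add (hc _) (hc _)]
  congr 1
  refine intervalIntegral.integral_congr fun θ _ => ?_
  have h1 : ((2 * Real.cos θ : ℝ) : ℂ)
      = Complex.exp (θ * Complex.I) + Complex.exp (-θ * Complex.I) := by
    push_cast
    rw [Complex.two_cos]
  have h2 : ∀ b : ℤ, Complex.exp (-((a + b : ℤ) * θ * Complex.I))
      = Complex.exp (-b * θ * Complex.I) * Complex.exp (-(a * θ * Complex.I)) := fun b => by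
    rw [← Complex.exp_add]
    congr 1
    push_cast
    ring
  have h3 := h2 1
  have h4 := h2 (-1)
  push_cast at h3 h4
  simp only [pow_succ, sub_eq_add_neg]
  push_cast at h1 ⊢
  rw [h3, h4, h1]
  ring_nf

/-- Every lattice path from slice `l` to slice `k` has the same net displacement, so the power
collapses to a number of paths times one shift. -/
theorem proj_mul_pow_mul_proj {d : ℕ} (j : Fin d) (m : ℕ) (k l : ℤ) :
    proj j k * (shift (Pi.single j 1) + shift (-Pi.single j 1)) ^ m * proj j l
      = cosCoeff m (k - l) • (shift (Pi.single j (l - k)) * proj j l) := by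
  induction m generalizing k with
  | zero =>
    rw [pow_zero, mul_one, proj_mul_proj, cosCoeff_zero]
    by_cases h : k = l
    · subst h; simp [shift_zero]
    · simp [h, sub_eq_zero]
  | succ m ih =>
    have h1 := shift_mul_proj_eq j k 1
    have h2 := shift_mul_proj_eq j k (-1)
    rw [Pi.single_neg] at h2
    rw [pow_succ', ← mul_assoc, mul_add, h1, h2, add_mul, mul_assoc, mul_assoc, add_mul,
      mul_assoc (shift _), mul_assoc (shift _), ih,
      ih, cosCoeff_succ, mul_smul_comm, mul_smul_comm, ← mul_assoc, ← mul_assoc, shift_mul_shift,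
      ← Pi.single_neg, shift_mul_shift, ← Pi.single_add, ← Pi.single_add, add_smul]
    ring_nf

/-- `i^{|a|} J_a(t/2)`: the Fourier coefficients of `exp (i (t/2) cos θ)`. -/
noncomputable def bes (a : ℤ) (t : ℝ) : ℂ :=
  (2 * Real.pi : ℂ)⁻¹ * ∫ θ in (0 : ℝ)..2 * Real.pi,
    Complex.exp ((t / 2 * Real.cos θ : ℝ) * Complex.I) * Complex.exp (-(a * θ * Complex.I))

/-- Expand `exp(i (t/2) cos θ)` in powers of `2 cos θ` and integrate termwise; the exponential
series of `|t| / 2` dominates. -/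
theorem hasSum_bes (a : ℤ) (t : ℝ) :
    HasSum (fun m : ℕ => ((m.factorial : ℂ)⁻¹ * (t / 4 * Complex.I) ^ m) * cosCoeff m a)
      (bes a t) := by
  have h := intervalIntegral.hasSum_integral_of_dominated_convergence
    (μ := MeasureTheory.volume) (a := 0) (b := 2 * Real.pi)
    (F := fun (m : ℕ) (θ : ℝ) => ((m.factorial : ℂ)⁻¹ * (t / 4 * Complex.I) ^ m) *
      (((2 * Real.cos θ : ℝ) : ℂ) ^ m * Complex.exp (-(a * θ * Complex.I))))
    (f := fun θ : ℝ => Complex.exp ((t / 2 * Real.cos θ : ℝ) * Complex.I) *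
      Complex.exp (-(a * θ * Complex.I)))
    (fun m _ => (m.factorial : ℝ)⁻¹ * (|t| / 2) ^ m)
    (fun m => Continuous.aestronglyMeasurable (by fun_prop)) ?_ ?_ ?_ ?_
  · have h1 := h.mul_left (2 * Real.pi : ℂ)⁻¹
    refine hasSum_of_eq h1 fun m => ?_
    rw [cosCoeff, intervalIntegral.integral_const_mul]
    ring
  · refine fun m => Filter.Eventually.of_forall fun θ _ => ?_
    have h1 : ‖Complex.exp (-(a * θ * Complex.I))‖ = 1 := by
      rw [Complex.norm_exp]; simp
    rw [norm_mul, norm_mul, norm_mul, h1, mul_one, norm_inv, Complex.norm_natCast, norm_pow,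
      norm_pow, mul_assoc, ← mul_pow]
    gcongr
    rw [norm_mul, Complex.norm_I, mul_one, norm_div, Complex.norm_real, Complex.norm_real,
      Real.norm_eq_abs, Real.norm_eq_abs, abs_mul]
    have h2 := Real.abs_cos_le_one θ
    have h3 := abs_nonneg t
    norm_num
    nlinarith
  · refine Filter.Eventually.of_forall fun θ _ => ?_
    simpa [div_eq_inv_mul] using Real.summable_pow_div_factorial (|t| / 2)
  · exact intervalIntegrable_const
  · refine Filter.Eventually.of_forall fun θ _ => ?_
    have h1 := (NormedSpace.exp_series_hasSum_exp' (𝕂 := ℂ)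
      ((t / 2 * Real.cos θ : ℝ) * Complex.I : ℂ)).mul_right (Complex.exp (-(a * θ * Complex.I)))
    rw [← Complex.exp_eq_exp_ℂ] at h1
    refine hasSum_of_eq h1 fun m => ?_
    have h2 : ((t / 2 * Real.cos θ : ℝ) * Complex.I : ℂ)
        = t / 4 * Complex.I * (2 * Real.cos θ : ℝ) := by
      push_cast
      ring
    rw [smul_eq_mul, h2, mul_pow]
    ring

/-- The constant part of `h0` gives the scalar phase; the exponential series of the hopping part is
summed block by block and compared with `hasSum_bes`. -/
theorem proj_mul_prop_h0_mul_proj {d : ℕ} (j : Fin d) (t : ℝ) (k l : ℤ) :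
    proj j k * prop (h0 j) t * proj j l = (Complex.exp (-(t / 2 * Complex.I)) * bes (k - l) t) •
      (shift (Pi.single j (l - k)) * proj j l) := by
  let _ : NormedAlgebra ℚ (Op d) := NormedAlgebra.restrictScalars ℚ ℂ (Op d)
  set B : Op d := shift (Pi.single j 1) + shift (-Pi.single j 1) with hB
  have h1 : (-(t : ℂ) * Complex.I) • (h0 j : Op d)
      = algebraMap ℂ (Op d) (-(t / 2 * Complex.I)) + (t / 4 * Complex.I) • B := by
    rw [h0, ← hB, Algebra.algebraMap_eq_smul_one, smul_sub, smul_smul, smul_smul, sub_eq_add_neg,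
      ← neg_smul]
    congr 2 <;> ring
  have h2 := NormedSpace.exp_series_hasSum_exp' (𝕂 := ℂ) ((t / 4 * Complex.I) • B)
  have h3 := (h2.mul_left (proj j k)).mul_right (proj j l)
  have h4 := (hasSum_bes (k - l) t).smul_const
    (shift (Pi.single j (l - k)) * proj j l : Op d)
  have h5 : proj j k * NormedSpace.exp ((t / 4 * Complex.I) • B) * proj j l
      = bes (k - l) t • (shift (Pi.single j (l - k)) * proj j l) := by
    refine h3.unique (hasSum_of_eq h4 fun m => ?_)
    rw [smul_pow, smul_smul, mul_smul_comm, smul_mul_assoc, proj_mul_pow_mul_proj, smul_smul]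
  rw [prop, h1, NormedSpace.exp_add_of_commute (Algebra.commutes _ _),
    ← NormedSpace.algebraMap_exp_comm, ← Complex.exp_eq_exp_ℂ, Algebra.algebraMap_eq_smul_one,
    smul_one_mul, mul_smul_comm, smul_mul_assoc, h5, smul_smul]

theorem norm_proj_mul_prop_h0_mul_proj_le {d : ℕ} (j : Fin d) (t : ℝ) (k l : ℤ) :
    ‖proj j k * prop (h0 j) t * proj j l‖ ≤ ‖bes (k - l) t‖ := by
  rw [proj_mul_prop_h0_mul_proj, norm_smul, norm_mul]
  have h1 : ‖Complex.exp (-(t / 2 * Complex.I))‖ = 1 := by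
    rw [Complex.norm_exp]; simp
  rw [h1, one_mul]
  refine mul_le_of_le_one_right (norm_nonneg _) ((norm_mul_le _ _).trans ?_)
  exact mul_le_one₀ (norm_shift_le _) (norm_nonneg _) (norm_proj_le _ _)

/-! ### Mean-square growth in time of the Bessel factors. -/

open MeasureTheory intervalIntegral Filter Topology

theorem abs_sin_rpow_periodic (p : ℝ) : Function.Periodic (fun x : ℝ => |Real.sin x| ^ p) Real.pi :=
  fun x => by simp [Real.sin_add_pi]

/-- Jordan's inequality `sin x ≥ 2x/π` compares with `x^(-p)` on `[0, π/2]`; reflection and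
periodicity do the rest. -/
theorem intervalIntegrable_abs_sin_rpow {p : ℝ} (hp : p < 1) (a b : ℝ) :
    IntervalIntegrable (fun x : ℝ => |Real.sin x| ^ (-p)) volume a b := by
  rcases le_or_gt p 0 with h0 | h0
  · exact (Continuous.rpow_const (by fun_prop) fun _ => Or.inr (by linarith)).intervalIntegrable _ _
  have hpi := Real.pi_pos
  have h1 : IntervalIntegrable (fun x : ℝ => |Real.sin x| ^ (-p)) volume 0 (Real.pi / 2) := by
    have h2 : IntervalIntegrable (fun x : ℝ => (2 / Real.pi) ^ (-p) * x ^ (-p)) volume 0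
        (Real.pi / 2) := (intervalIntegrable_rpow' (by linarith)).const_mul _
    refine h2.mono_fun' (Measurable.aestronglyMeasurable (by fun_prop)) ?_
    refine (ae_restrict_iff' measurableSet_uIoc).2 (Filter.Eventually.of_forall fun x hx => ?_)
    rw [Set.uIoc_of_le (by positivity)] at hx
    have h3 := Real.mul_le_sin hx.1.le hx.2
    have h4 : 0 < 2 / Real.pi * x := mul_pos (by positivity) hx.1
    simp only
    rw [Real.norm_of_nonneg (Real.rpow_nonneg (abs_nonneg _) _), abs_of_pos (h4.trans_le h3),
      ← Real.mul_rpow (by positivity) hx.1.le]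
    exact Real.rpow_le_rpow_of_nonpos h4 h3 (by linarith)
  have h2 := h1.comp_sub_left Real.pi
  simp only [Real.sin_pi_sub, sub_zero] at h2
  have h3 : Real.pi - Real.pi / 2 = Real.pi / 2 := by ring
  rw [h3] at h2
  refine (abs_sin_rpow_periodic (-p)).intervalIntegrable hpi.ne' (t := 0) ?_ a b
  rw [zero_add]
  exact h1.trans h2.symm

theorem ae_sin_ne_zero {b : ℝ} (hb : b ≠ 0) (c : ℝ) : ∀ᵐ x : ℝ, Real.sin (b * x + c) ≠ 0 := by
  have h : {x : ℝ | Real.sin (b * x + c) = 0} ⊆ Set.range fun n : ℤ => (n * Real.pi - c) / b := by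
    intro x hx
    obtain ⟨n, hn⟩ := Real.sin_eq_zero_iff.1 hx
    refine ⟨n, ?_⟩
    simp only [hn]
    field_simp
    ring
  exact ((Set.countable_range _).mono h).ae_notMem volume

theorem intervalIntegral_swap_of_continuous {f : ℝ → ℝ → ℂ} (hf : Continuous (Function.uncurry f))
    (a b c d : ℝ) : ∫ x in a..b, ∫ y in c..d, f x y = ∫ y in c..d, ∫ x in a..b, f x y := by
  refine intervalIntegral_intervalIntegral_swap ?_
  refine (hf.continuousOn.integrableOn_compact ((isCompact_uIcc (a := a) (b := b)).prod
    (isCompact_uIcc (a := c) (b := d)))).mono_set ?_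
  exact Set.prod_mono Set.uIoc_subset_uIcc Set.uIoc_subset_uIcc

/-- The truncated oscillatory integral `∫₀ᵀ exp (ity) dt`. -/
noncomputable def osc (T y : ℝ) : ℂ := ∫ t in (0 : ℝ)..T, Complex.exp ((t * y : ℝ) * Complex.I)

theorem norm_osc_le {T : ℝ} (hT : 0 ≤ T) {e : ℝ} (he0 : 0 ≤ e) (he1 : e ≤ 1) {y : ℝ} (hy : y ≠ 0) :
    ‖osc T y‖ ≤ 2 * T ^ e * |y| ^ (-(1 - e)) := by
  have h1 : ‖osc T y‖ ≤ T := by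
    have := norm_integral_le_of_norm_le_const (a := 0) (b := T) (C := 1)
      (f := fun t : ℝ => Complex.exp ((t * y : ℝ) * Complex.I))
      fun t _ => (Complex.norm_exp_ofReal_mul_I _).le
    rwa [one_mul, sub_zero, abs_of_nonneg hT] at this
  have h2 : ‖osc T y‖ ≤ 2 / |y| := by
    have hc : (y * Complex.I : ℂ) ≠ 0 := by simp [hy]
    have e1 : osc T y = ∫ t in (0 : ℝ)..T, Complex.exp (y * Complex.I * t) := by
      refine integral_congr fun t _ => congrArg Complex.exp ?_
      push_cast
      ring
    rw [e1, integral_exp_mul_complex hc, norm_div, norm_mul, Complex.norm_I, mul_one,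
      Complex.norm_real, Real.norm_eq_abs]
    gcongr
    refine (norm_sub_le _ _).trans ?_
    have e2 : (y * Complex.I * T : ℂ) = (y * T : ℝ) * Complex.I := by push_cast; ring
    rw [e2, Complex.norm_exp_ofReal_mul_I]
    norm_num
  have h0 := norm_nonneg (osc T y)
  have hy' : 0 < |y| := abs_pos.2 hy
  -- Geometric interpolation between the bounds `T` and `2 / |y|`.
  calc ‖osc T y‖ = ‖osc T y‖ ^ e * ‖osc T y‖ ^ (1 - e) := by
        rw [← Real.rpow_add_of_nonneg h0 he0 (by linarith)]; simp
    _ ≤ T ^ e * (2 / |y|) ^ (1 - e) := by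
        gcongr
    _ = T ^ e * (2 ^ (1 - e) * |y| ^ (-(1 - e))) := by
        rw [Real.div_rpow (by norm_num) hy'.le, Real.rpow_neg hy'.le]; rfl
    _ ≤ T ^ e * (2 ^ (1 : ℝ) * |y| ^ (-(1 - e))) := by
        gcongr
        · norm_num
        · linarith
    _ = _ := by rw [Real.rpow_one]; ring

/-- The integrand of `bes`. -/
noncomputable def besKer (a : ℤ) (t θ : ℝ) : ℂ :=
  Complex.exp ((t / 2 * Real.cos θ : ℝ) * Complex.I) * Complex.exp (-(a * θ * Complex.I))

theorem besKer_periodic (a : ℤ) (t : ℝ) : Function.Periodic (besKer a t) (2 * Real.pi) := by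
  intro θ
  have h : Complex.exp (-(a * (θ + 2 * Real.pi : ℝ) * Complex.I))
      = Complex.exp (-(a * θ * Complex.I)) *
        Complex.exp ((-a : ℤ) * (2 * Real.pi * Complex.I)) := by
    rw [← Complex.exp_add]
    congr 1
    push_cast
    ring
  rw [besKer, besKer, h, Complex.exp_int_mul_two_pi_mul_I, mul_one, Real.cos_add_two_pi]

theorem continuous_besKer (a : ℤ) : Continuous fun x : ℝ × ℝ => besKer a x.1 x.2 := by
  unfold besKer
  fun_prop

theorem conj_bes (a : ℤ) (t : ℝ) : (starRingEnd ℂ) (bes a t) = bes (-a) (-t) := by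
  rw [bes, bes, map_mul, ← intervalIntegral_conj]
  congr 1
  · simp [map_ofNat]
  · refine integral_congr fun θ _ => ?_
    simp only [map_mul, ← Complex.exp_conj, Complex.conj_ofReal, Complex.conj_I, map_neg,
      map_intCast]
    congr 2 <;> push_cast <;> ring

theorem norm_bes_neg (a : ℤ) (t : ℝ) : ‖bes a (-t)‖ = ‖bes (-a) t‖ := by
  rw [← Complex.norm_conj, conj_bes, neg_neg]

/-- Write the square as a double integral and substitute `ψ = φ + θ`. The difference of the cosines
in the phase then factors into sines, which separates the singularities once `t` is integrated. -/
theorem norm_sq_bes (a : ℤ) (t : ℝ) : ((‖bes a t‖ ^ 2 : ℝ) : ℂ) =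
    (2 * Real.pi : ℂ)⁻¹ ^ 2 * ∫ φ in (0 : ℝ)..2 * Real.pi, ∫ θ in (0 : ℝ)..2 * Real.pi,
      Complex.exp ((t * -(Real.sin (φ / 2) * Real.sin (θ + φ / 2)) : ℝ) * Complex.I) *
        Complex.exp (-(a * φ * Complex.I)) := by
  have h1 : ((‖bes a t‖ ^ 2 : ℝ) : ℂ) = bes a t * (starRingEnd ℂ) (bes a t) := by
    rw [Complex.mul_conj, Complex.normSq_eq_norm_sq]
  have h2 : bes a t = (2 * Real.pi : ℂ)⁻¹ * ∫ θ in (0 : ℝ)..2 * Real.pi, besKer a t θ := rfl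
  have h3 : (starRingEnd ℂ) (2 * Real.pi : ℂ)⁻¹ = (2 * Real.pi : ℂ)⁻¹ := by simp [map_ofNat]
  have hk := continuous_besKer a
  rw [h1, h2, map_mul, h3, ← intervalIntegral_conj, mul_mul_mul_comm, ← sq,
    ← intervalIntegral.integral_const_mul, intervalIntegral_swap_of_continuous (by
      simp only [Function.uncurry_def]; fun_prop)]
  congr 1
  refine integral_congr fun θ _ => ?_
  have h4 : ∫ ψ in (0 : ℝ)..2 * Real.pi, besKer a t ψ
      = ∫ φ in (0 : ℝ)..2 * Real.pi, besKer a t (φ + θ) := by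
    rw [integral_comp_add_right, zero_add, add_comm,
      (besKer_periodic a t).intervalIntegral_add_eq θ 0, zero_add]
  rw [h4, ← intervalIntegral.integral_mul_const]
  refine integral_congr fun φ _ => ?_
  simp only [besKer, ← Complex.exp_conj, ← Complex.exp_add]
  congr 1
  have h5 : Real.cos (φ + θ) - Real.cos θ = -2 * (Real.sin (φ / 2) * Real.sin (θ + φ / 2)) := by
    rw [Real.cos_sub_cos]
    ring_nf
  have h6 := congrArg (fun x : ℝ => (x : ℂ)) h5
  simp only [map_add, map_mul, map_neg, Complex.conj_ofReal, Complex.conj_I, map_intCast]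
  push_cast at h6 ⊢
  linear_combination (t / 2 * Complex.I) * h6

theorem integral_abs_sin_rpow_add (p c : ℝ) :
    ∫ θ in (0 : ℝ)..2 * Real.pi, |Real.sin (θ + c)| ^ p
      = ∫ θ in (0 : ℝ)..2 * Real.pi, |Real.sin θ| ^ p := by
  have h : Function.Periodic (fun x : ℝ => |Real.sin x| ^ p) (2 * Real.pi) := fun x => by
    simp [Real.sin_add_two_pi]
  rw [integral_comp_add_right (fun x : ℝ => |Real.sin x| ^ p), zero_add, add_comm,
    h.intervalIntegral_add_eq c 0, zero_add]

theorem norm_exp_neg_int_mul (a : ℤ) (φ : ℝ) : ‖Complex.exp (-(a * φ * Complex.I))‖ = 1 := by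
  rw [Complex.norm_exp]
  simp

theorem integral_norm_sq_bes (a : ℤ) (T : ℝ) :
    ((∫ t in (0 : ℝ)..T, ‖bes a t‖ ^ 2 : ℝ) : ℂ) = (2 * Real.pi : ℂ)⁻¹ ^ 2 *
      ∫ φ in (0 : ℝ)..2 * Real.pi, ∫ θ in (0 : ℝ)..2 * Real.pi,
        osc T (-(Real.sin (φ / 2) * Real.sin (θ + φ / 2))) *
          Complex.exp (-(a * φ * Complex.I)) := by
  rw [← intervalIntegral.integral_ofReal]
  simp_rw [norm_sq_bes]
  rw [intervalIntegral.integral_const_mul, intervalIntegral_swap_of_continuous (by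
    simp only [Function.uncurry_def]; fun_prop)]
  congr 1
  refine integral_congr fun φ _ => ?_
  rw [intervalIntegral_swap_of_continuous (by
    simp only [Function.uncurry_def]; fun_prop)]
  refine integral_congr fun θ _ => ?_
  rw [intervalIntegral.integral_mul_const, osc]

theorem norm_two_pi_inv : ‖(2 * Real.pi : ℂ)⁻¹‖ = (2 * Real.pi)⁻¹ := by
  rw [norm_inv, norm_mul, Complex.norm_real, Real.norm_of_nonneg Real.pi_pos.le]
  simp

/-- By `norm_osc_le` the time integral costs `T^e` and leaves `|sin(φ/2)|` and `|sin(θ + φ/2)|` to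
the power `-(1 - e)`, both integrable. Taking norms removes the dependence on `a`. -/
theorem exists_integral_norm_sq_bes_le {e : ℝ} (he0 : 0 < e) (he1 : e ≤ 1) :
    ∃ C, 0 ≤ C ∧ ∀ (a : ℤ) (T : ℝ), 0 ≤ T → ∫ t in (0 : ℝ)..T, ‖bes a t‖ ^ 2 ≤ C * T ^ e := by
  have hpi := Real.pi_pos
  have hp : 1 - e < 1 := by linarith
  set K := ∫ θ in (0 : ℝ)..2 * Real.pi, |Real.sin θ| ^ (-(1 - e)) with hK
  set L := ∫ φ in (0 : ℝ)..2 * Real.pi, |Real.sin (φ / 2)| ^ (-(1 - e)) with hL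
  have hK0 : 0 ≤ K := integral_nonneg (by positivity) fun _ _ => Real.rpow_nonneg (abs_nonneg _) _
  have hL0 : 0 ≤ L := integral_nonneg (by positivity) fun _ _ => Real.rpow_nonneg (abs_nonneg _) _
  refine ⟨(2 * Real.pi)⁻¹ ^ 2 * (2 * L * K), by positivity, fun a T hT => ?_⟩
  have hint : IntervalIntegrable (fun φ : ℝ => |Real.sin (φ / 2)| ^ (-(1 - e))) volume 0
      (2 * Real.pi) := by
    have h := (intervalIntegrable_abs_sin_rpow hp 0 Real.pi).comp_mul_left (c := 1 / 2)
    have e1 : Real.pi / (1 / 2) = 2 * Real.pi := by ring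
    rw [zero_div, e1] at h
    simpa only [one_div_mul_eq_div] using h
  have hint' : ∀ c : ℝ, IntervalIntegrable (fun θ : ℝ => |Real.sin (θ + c)| ^ (-(1 - e))) volume 0
      (2 * Real.pi) := fun c => by
    have h := (intervalIntegrable_abs_sin_rpow hp c (2 * Real.pi + c)).comp_add_right c
    simpa only [sub_self, add_sub_cancel_right] using h
  have hnn : 0 ≤ ∫ t in (0 : ℝ)..T, ‖bes a t‖ ^ 2 :=
    integral_nonneg hT fun _ _ => sq_nonneg _
  rw [← Real.norm_of_nonneg hnn, ← Complex.norm_real, integral_norm_sq_bes, norm_mul, mul_assoc,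
    norm_pow]
  rw [norm_two_pi_inv]
  refine mul_le_mul_of_nonneg_left ?_ (by positivity)
  have h2 : 2 * L * K * T ^ e = ∫ φ in (0 : ℝ)..2 * Real.pi,
      2 * T ^ e * K * |Real.sin (φ / 2)| ^ (-(1 - e)) := by
    rw [intervalIntegral.integral_const_mul]
    ring
  rw [h2]
  refine norm_integral_le_of_norm_le (by positivity) ?_ (hint.const_mul _)
  filter_upwards [ae_sin_ne_zero (b := 1 / 2) (by norm_num) 0] with φ hφ _
  rw [add_zero, one_div_mul_eq_div] at hφ
  have h3 : 2 * T ^ e * K * |Real.sin (φ / 2)| ^ (-(1 - e)) = ∫ θ in (0 : ℝ)..2 * Real.pi,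
      2 * T ^ e * |Real.sin (φ / 2)| ^ (-(1 - e)) * |Real.sin (θ + φ / 2)| ^ (-(1 - e)) := by
    rw [intervalIntegral.integral_const_mul, integral_abs_sin_rpow_add]
    ring
  rw [h3]
  refine norm_integral_le_of_norm_le (by positivity) ?_ ((hint' _).const_mul _)
  filter_upwards [ae_sin_ne_zero (b := 1) one_ne_zero (φ / 2)] with θ hθ _
  rw [one_mul] at hθ
  rw [norm_mul, norm_exp_neg_int_mul, mul_one]
  refine (norm_osc_le hT he0.le he1 (neg_ne_zero.2 (mul_ne_zero hφ hθ))).trans_eq ?_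
  rw [abs_neg, abs_mul, Real.mul_rpow (abs_nonneg _) (abs_nonneg _)]
  ring

/-! ### Pointwise decay of the Bessel factors. -/

theorem norm_besKer (a : ℤ) (t θ : ℝ) : ‖besKer a t θ‖ = 1 := by
  rw [besKer, norm_mul, Complex.norm_exp_ofReal_mul_I, norm_exp_neg_int_mul, one_mul]

theorem norm_bes_le_one (a : ℤ) (t : ℝ) : ‖bes a t‖ ≤ 1 := by
  have hpi := Real.pi_pos
  have h := norm_integral_le_of_norm_le_const (a := 0) (b := 2 * Real.pi) (C := 1)
    (f := besKer a t) fun θ _ => (norm_besKer a t θ).le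
  rw [one_mul, sub_zero, abs_of_pos (by positivity)] at h
  have h2 : bes a t = (2 * Real.pi : ℂ)⁻¹ * ∫ θ in (0 : ℝ)..2 * Real.pi, besKer a t θ := rfl
  rw [h2, norm_mul, norm_two_pi_inv]
  calc _ ≤ (2 * Real.pi)⁻¹ * (2 * Real.pi) := by gcongr
    _ = 1 := inv_mul_cancel₀ (by positivity)

theorem continuous_bes (a : ℤ) : Continuous (bes a) := by
  unfold bes
  fun_prop

theorem hasDerivAt_sin_div {η : ℝ} (hη : 0 < η) (θ : ℝ) :
    HasDerivAt (fun θ : ℝ => Real.sin θ / (Real.sin θ ^ 2 + η))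
      (Real.cos θ * (η - Real.sin θ ^ 2) / (Real.sin θ ^ 2 + η) ^ 2) θ := by
  have h0 : Real.sin θ ^ 2 + η ≠ 0 := by positivity
  refine ((Real.hasDerivAt_sin θ).div (((Real.hasDerivAt_sin θ).pow 2).add_const η)
    h0).congr_deriv ?_
  congr 1
  rw [Pi.pow_apply]
  push_cast
  ring

/-- Integration by parts: one factor `sin θ` is used up by the derivative of the phase `(t/2) cos
θ`, and the other makes the boundary terms vanish. Differentiating `exp(-iaθ)` produces `|a|`. -/
theorem norm_integral_besKer_mul_le (a : ℤ) {t η : ℝ} (ht : 0 < t) (hη : 0 < η) :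
    ‖∫ θ in (0 : ℝ)..2 * Real.pi,
      besKer a t θ * (Real.sin θ ^ 2 / (Real.sin θ ^ 2 + η) : ℝ)‖
      ≤ 4 * Real.pi * (1 + |(a : ℝ)|) / (t * η) := by
  have hpi := Real.pi_pos
  have hpos : ∀ θ : ℝ, 0 < Real.sin θ ^ 2 + η := fun θ => by positivity
  set u : ℝ → ℂ := fun θ => Complex.exp ((t / 2 * Real.cos θ : ℝ) * Complex.I) with hu
  set u' : ℝ → ℂ := fun θ => Complex.exp ((t / 2 * Real.cos θ : ℝ) * Complex.I) *
    ((t / 2 * -Real.sin θ : ℝ) * Complex.I) with hu'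
  set w : ℝ → ℝ := fun θ => Real.sin θ / (Real.sin θ ^ 2 + η) with hw
  set w' : ℝ → ℝ := fun θ => Real.cos θ * (η - Real.sin θ ^ 2) / (Real.sin θ ^ 2 + η) ^ 2 with hw'
  set v : ℝ → ℂ := fun θ => Complex.exp (-(a * θ * Complex.I)) * (w θ : ℂ) with hv
  set v' : ℝ → ℂ := fun θ => Complex.exp (-(a * θ * Complex.I)) * (-(a * 1 * Complex.I)) * (w θ : ℂ)
    + Complex.exp (-(a * θ * Complex.I)) * (w' θ : ℂ) with hv'
  have hdu : ∀ θ : ℝ, HasDerivAt u (u' θ) θ := fun θ =>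
    ((((Real.hasDerivAt_cos θ).const_mul (t / 2)).ofReal_comp).mul_const Complex.I).cexp
  have hdv : ∀ θ : ℝ, HasDerivAt v (v' θ) θ := fun θ =>
    (((((hasDerivAt_id θ).ofReal_comp).const_mul (a : ℂ)).mul_const Complex.I).neg.cexp).mul
      (hasDerivAt_sin_div hη θ).ofReal_comp
  have hcw : Continuous w := Continuous.div (by fun_prop) (by fun_prop) fun θ => (hpos θ).ne'
  have hcw' : Continuous w' := Continuous.div (by fun_prop) (by fun_prop)
    fun θ => (pow_pos (hpos θ) 2).ne'
  have hcu' : Continuous u' := by fun_prop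
  have hcv' : Continuous v' := by fun_prop
  have hibp := integral_mul_deriv_eq_deriv_mul (a := 0) (b := 2 * Real.pi) (fun θ _ => hdu θ)
    (fun θ _ => hdv θ) (hcu'.intervalIntegrable _ _) (hcv'.intervalIntegrable _ _)
  have hv0 : v 0 = 0 := by simp [hv, hw]
  have hv1 : v (2 * Real.pi) = 0 := by simp [hv, hw]
  rw [hv0, hv1, mul_zero, mul_zero, sub_zero, zero_sub] at hibp
  have h1 : ∫ θ in (0 : ℝ)..2 * Real.pi, u' θ * v θ = (-(t / 2) * Complex.I) *
      ∫ θ in (0 : ℝ)..2 * Real.pi,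
        besKer a t θ * (Real.sin θ ^ 2 / (Real.sin θ ^ 2 + η) : ℝ) := by
    rw [← intervalIntegral.integral_const_mul]
    refine integral_congr fun θ _ => ?_
    simp only [hu', hv, hw, besKer]
    push_cast
    ring
  have h2 : ‖∫ θ in (0 : ℝ)..2 * Real.pi, u θ * v' θ‖ ≤ (1 + |(a : ℝ)|) / η * (2 * Real.pi) := by
    have h3 := norm_integral_le_of_norm_le_const (a := 0) (b := 2 * Real.pi)
      (C := (1 + |(a : ℝ)|) / η) (f := fun θ => u θ * v' θ) fun θ _ => by
        have hs0 := sq_nonneg (Real.sin θ)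
        have hs : |Real.sin θ| ≤ 1 := Real.abs_sin_le_one θ
        have hc : |Real.cos θ| ≤ 1 := Real.abs_cos_le_one θ
        have e1 : |w θ| ≤ 1 / η := by
          rw [hw, abs_div, abs_of_pos (hpos θ)]
          gcongr
          linarith
        have e2 : |w' θ| ≤ 1 / η := by
          rw [hw', abs_div, abs_of_pos (pow_pos (hpos θ) 2), abs_mul,
            div_le_div_iff₀ (pow_pos (hpos θ) 2) hη,
            one_mul]
          have e3 : |η - Real.sin θ ^ 2| ≤ Real.sin θ ^ 2 + η := abs_le.2 ⟨by linarith, by linarith⟩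
          calc |Real.cos θ| * |η - Real.sin θ ^ 2| * η
              ≤ 1 * (Real.sin θ ^ 2 + η) * (Real.sin θ ^ 2 + η) := by
                gcongr
                linarith
            _ = _ := by ring
        rw [norm_mul, hu, Complex.norm_exp_ofReal_mul_I, one_mul]
        refine (norm_add_le _ _).trans ?_
        rw [norm_mul, norm_mul, norm_mul, norm_exp_neg_int_mul, one_mul, one_mul, Complex.norm_real,
          Complex.norm_real, Real.norm_eq_abs, Real.norm_eq_abs, mul_one, norm_neg, norm_mul,
          Complex.norm_I, mul_one, Complex.norm_intCast]
        calc |(a : ℝ)| * |w θ| + |w' θ| ≤ |(a : ℝ)| * (1 / η) + 1 / η := by gcongr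
          _ = _ := by ring
    rwa [sub_zero, abs_of_pos (by positivity : 0 < 2 * Real.pi)] at h3
  rw [hibp, h1, norm_neg, norm_mul] at h2
  have h4 : ‖(-(t / 2) * Complex.I : ℂ)‖ = t / 2 := by
    rw [norm_mul, norm_neg, Complex.norm_I, mul_one, norm_div, Complex.norm_real,
      Real.norm_of_nonneg ht.le]
    simp
  rw [h4] at h2
  rw [le_div_iff₀ (by positivity)]
  have h5 := mul_le_mul_of_nonneg_right h2 hη.le
  have h6 : (1 + |(a : ℝ)|) / η * (2 * Real.pi) * η = (1 + |(a : ℝ)|) * (2 * Real.pi) := by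
    field_simp
  rw [h6] at h5
  linarith

/-- A number in `[0, 1]` is at most its fourth root. -/
theorem div_le_rpow_mul_abs_rpow {x η : ℝ} (hη : 0 < η) (hx : x ≠ 0) :
    η / (x ^ 2 + η) ≤ η ^ (1 / 4 : ℝ) * |x| ^ (-(1 / 2) : ℝ) := by
  have hx' : 0 < |x| := abs_pos.2 hx
  have hx2 : 0 < x ^ 2 := by positivity
  have h1 : η / (x ^ 2 + η) ≤ 1 := (div_le_one (by positivity)).2 (by linarith)
  calc η / (x ^ 2 + η) ≤ (η / (x ^ 2 + η)) ^ (1 / 4 : ℝ) := by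
        conv_lhs => rw [← Real.rpow_one (η / (x ^ 2 + η))]
        exact Real.rpow_le_rpow_of_exponent_ge (by positivity) h1 (by norm_num)
    _ ≤ (η / x ^ 2) ^ (1 / 4 : ℝ) := by
        gcongr
        linarith
    _ = _ := by
        rw [Real.div_rpow hη.le hx2.le, ← sq_abs, ← Real.rpow_natCast, ← Real.rpow_mul hx'.le,
          Real.rpow_neg hx'.le]
        norm_num
        rfl

/-- A smooth partition `1 = η/(sin² + η) + sin²/(sin² + η)` separates the critical points of the
phase, controlled by size, from the rest, controlled by integration by parts. The rate is far from
optimal, but any power suffices. -/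
theorem exists_norm_bes_le : ∃ C, 0 ≤ C ∧ ∀ (a : ℤ) (t : ℝ), 0 ≤ t →
    ‖bes a t‖ ≤ C * (1 + |(a : ℝ)|) * (1 + t) ^ (-(1 / 8) : ℝ) := by
  have hpi := Real.pi_pos
  set K := ∫ θ in (0 : ℝ)..2 * Real.pi, |Real.sin θ| ^ (-(1 / 2) : ℝ) with hK
  have hK0 : 0 ≤ K := integral_nonneg (by positivity) fun _ _ => Real.rpow_nonneg (abs_nonneg _) _
  refine ⟨2 + K + 4, by positivity, fun a t ht => ?_⟩
  rcases le_total t 1 with h1 | h1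
  · refine (norm_bes_le_one a t).trans ?_
    have h2 : (1 : ℝ) / 2 ≤ (1 + t) ^ (-(1 / 8) : ℝ) := by
      rw [Real.rpow_neg (by positivity), one_div]
      gcongr
      calc (1 + t) ^ (1 / 8 : ℝ) ≤ 2 ^ (1 / 8 : ℝ) := by gcongr; linarith
        _ ≤ 2 ^ (1 : ℝ) := by gcongr <;> norm_num
        _ = 2 := by norm_num
    have h3 : 2 * 1 ≤ (2 + K + 4) * (1 + |(a : ℝ)|) := by
      gcongr
      · linarith
      · linarith [abs_nonneg (a : ℝ)]
    calc (1 : ℝ) = 2 * 1 * (1 / 2) := by norm_num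
      _ ≤ _ := by gcongr
  have ht1 : 0 < 1 + t := by linarith
  -- With this `η` the critical part is of order `η^(1/4) = (1+t)^(-1/8)` and the other, `1/(tη)`,
  -- is smaller still.
  set η := (1 + t) ^ (-(1 / 2) : ℝ) with hη
  have hη0 : 0 < η := Real.rpow_pos_of_pos ht1 _
  have hη1 : η ≤ 1 := Real.rpow_le_one_of_one_le_of_nonpos (by linarith) (by norm_num)
  have hpos : ∀ θ : ℝ, 0 < Real.sin θ ^ 2 + η := fun θ => by positivity
  have hck : Continuous fun θ => besKer a t θ := by
    have := continuous_besKer a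
    fun_prop
  have hc1 : Continuous fun θ : ℝ => (η / (Real.sin θ ^ 2 + η) : ℝ) :=
    Continuous.div (by fun_prop) (by fun_prop) fun θ => (hpos θ).ne'
  have hc2 : Continuous fun θ : ℝ => (Real.sin θ ^ 2 / (Real.sin θ ^ 2 + η) : ℝ) :=
    Continuous.div (by fun_prop) (by fun_prop) fun θ => (hpos θ).ne'
  have hsplit : bes a t = (2 * Real.pi : ℂ)⁻¹ * ((∫ θ in (0 : ℝ)..2 * Real.pi,
      besKer a t θ * (η / (Real.sin θ ^ 2 + η) : ℝ)) + ∫ θ in (0 : ℝ)..2 * Real.pi,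
      besKer a t θ * (Real.sin θ ^ 2 / (Real.sin θ ^ 2 + η) : ℝ)) := by
    rw [← intervalIntegral.integral_add (Continuous.intervalIntegrable (by fun_prop) _ _)
      (Continuous.intervalIntegrable (by fun_prop) _ _), bes]
    congr 1
    refine integral_congr fun θ _ => ?_
    have e1 : η / (Real.sin θ ^ 2 + η) + Real.sin θ ^ 2 / (Real.sin θ ^ 2 + η) = 1 := by
      rw [← add_div, add_comm, div_self (hpos θ).ne']
    rw [← mul_add, ← Complex.ofReal_add, e1, Complex.ofReal_one, mul_one, besKer]
  have hA : ‖∫ θ in (0 : ℝ)..2 * Real.pi, besKer a t θ * (η / (Real.sin θ ^ 2 + η) : ℝ)‖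
      ≤ (1 + t) ^ (-(1 / 8) : ℝ) * K := by
    rw [hK, ← intervalIntegral.integral_const_mul]
    refine norm_integral_le_of_norm_le (by positivity) ?_
      ((intervalIntegrable_abs_sin_rpow (by norm_num) _ _).const_mul _)
    filter_upwards [ae_sin_ne_zero (b := 1) one_ne_zero 0] with θ hθ _
    rw [one_mul, add_zero] at hθ
    rw [norm_mul, norm_besKer, one_mul, Complex.norm_real, Real.norm_of_nonneg (by positivity)]
    refine (div_le_rpow_mul_abs_rpow hη0 hθ).trans_eq ?_
    rw [hη, ← Real.rpow_mul ht1.le]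
    norm_num
  have hB := norm_integral_besKer_mul_le a (by linarith : 0 < t) hη0
  have hB' : 4 * Real.pi * (1 + |(a : ℝ)|) / (t * η)
      ≤ 2 * Real.pi * (4 * (1 + |(a : ℝ)|) * (1 + t) ^ (-(1 / 8) : ℝ)) := by
    rw [div_le_iff₀ (by positivity)]
    have e1 : 1 ≤ 2 * ((1 + t) ^ (-(1 / 8) : ℝ) * (t * η)) := by
      have e2 : (1 + t) / 2 ≤ t := by linarith
      have e3 : (1 + t) ^ (-(1 / 8) : ℝ) * ((1 + t) * η) = (1 + t) ^ (3 / 8 : ℝ) := by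
        rw [hη]
        nth_rewrite 2 [← Real.rpow_one (1 + t)]
        rw [← Real.rpow_add ht1, ← Real.rpow_add ht1]
        norm_num
      calc (1 : ℝ) ≤ (1 + t) ^ (3 / 8 : ℝ) :=
            Real.one_le_rpow (by linarith) (by norm_num)
        _ = 2 * ((1 + t) ^ (-(1 / 8) : ℝ) * ((1 + t) / 2 * η)) := by rw [← e3]; ring
        _ ≤ _ := by gcongr
    have e4 : 0 ≤ 4 * Real.pi * (1 + |(a : ℝ)|) := by positivity
    nlinarith [mul_le_mul_of_nonneg_left e1 e4]
  rw [hsplit, norm_mul, norm_two_pi_inv, inv_mul_le_iff₀ (by positivity)]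
  refine (norm_add_le _ _).trans ((add_le_add hA (hB.trans hB')).trans ?_)
  have h8 : 0 ≤ (1 + t) ^ (-(1 / 8) : ℝ) := by positivity
  have e5 : (1 + t) ^ (-(1 / 8) : ℝ) * K
      ≤ 2 * Real.pi * ((2 + K) * (1 + |(a : ℝ)|) * (1 + t) ^ (-(1 / 8) : ℝ)) := by
    have e6 : 1 * K * 1 ≤ 2 * Real.pi * (2 + K) * (1 + |(a : ℝ)|) := by
      gcongr
      · linarith [Real.pi_gt_three]
      · linarith
      · linarith [abs_nonneg (a : ℝ)]
    nlinarith [mul_le_mul_of_nonneg_right e6 h8]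
  linarith

/-! ### Uniform time integrability after a small power gain. -/

theorem continuousOn_one_add_rpow (r : ℝ) {T : ℝ} (hT : 0 ≤ T) :
    ContinuousOn (fun t : ℝ => (1 + t) ^ r) (Set.uIcc 0 T) := by
  rw [Set.uIcc_of_le hT]
  refine ContinuousOn.rpow_const (by fun_prop) fun t ht => Or.inl ?_
  linarith [ht.1]

theorem hasDerivAt_one_add_rpow (r : ℝ) {t : ℝ} (ht : 0 ≤ t) :
    HasDerivAt (fun t : ℝ => (1 + t) ^ r) (r * (1 + t) ^ (r - 1)) t := by
  have h := ((hasDerivAt_id t).const_add 1).rpow_const (p := r) (Or.inl (by simp; linarith))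
  simpa using h

theorem integral_one_add_rpow_le {r : ℝ} (hr : 0 < r) {T : ℝ} (hT : 0 ≤ T) :
    ∫ t in (0 : ℝ)..T, (1 + t) ^ (-r - 1) ≤ 1 / r := by
  have h := integral_eq_sub_of_hasDerivAt (a := 0) (b := T)
    (f := fun t : ℝ => (1 + t) ^ (-r)) (f' := fun t => -r * (1 + t) ^ (-r - 1))
    (fun t ht => by
      rw [Set.uIcc_of_le hT] at ht
      exact hasDerivAt_one_add_rpow _ ht.1)
    ((continuousOn_const.mul (continuousOn_one_add_rpow _ hT)).intervalIntegrable)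
  rw [intervalIntegral.integral_const_mul, add_zero, Real.one_rpow] at h
  have h2 : 0 ≤ (1 + T) ^ (-r) := by positivity
  rw [le_div_iff₀ hr]
  linarith

/-- Integrate by parts against the primitive of `F`: growth `T^e` of the primitive loses to `(1 +
t)^(-δ)` because `e < δ`. -/
theorem integral_mul_rpow_neg_le {F : ℝ → ℝ} (hF : Continuous F) {C e δ : ℝ}
    (hC : 0 ≤ C) (he : 0 ≤ e) (hδ : e < δ)
    (h : ∀ T, 0 ≤ T → ∫ t in (0 : ℝ)..T, F t ≤ C * T ^ e) {T : ℝ} (hT : 0 ≤ T) :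
    ∫ t in (0 : ℝ)..T, F t * (1 + t) ^ (-δ) ≤ C * (1 + δ / (δ - e)) := by
  have hde : 0 < δ - e := by linarith
  have hbd : ∀ r t : ℝ, 0 ≤ t → C * t ^ e * (1 + t) ^ r ≤ C * (1 + t) ^ (e + r) := fun r t ht => by
    rw [Real.rpow_add (by linarith), mul_assoc]
    gcongr
    linarith
  set Φ : ℝ → ℝ := fun t => ∫ τ in (0 : ℝ)..t, F τ with hΦ
  have hdΦ : ∀ t, HasDerivAt Φ (F t) t := fun t =>
    integral_hasDerivAt_right (hF.intervalIntegrable _ _)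
      hF.stronglyMeasurable.stronglyMeasurableAtFilter hF.continuousAt
  have hcΦ : Continuous Φ := continuous_iff_continuousAt.2 fun t => (hdΦ t).continuousAt
  have hib := integral_mul_deriv_eq_deriv_mul (a := 0) (b := T) (v := Φ) (v' := F)
    (u := fun t : ℝ => (1 + t) ^ (-δ)) (u' := fun t => -δ * (1 + t) ^ (-δ - 1))
    (fun t ht => by
      rw [Set.uIcc_of_le hT] at ht
      exact hasDerivAt_one_add_rpow _ ht.1) (fun t _ => hdΦ t)
    ((continuousOn_const.mul (continuousOn_one_add_rpow _ hT)).intervalIntegrable)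
    (hF.intervalIntegrable _ _)
  have hΦ0 : Φ 0 = 0 := integral_same
  rw [hΦ0, mul_zero, sub_zero] at hib
  have e1 : ∫ t in (0 : ℝ)..T, F t * (1 + t) ^ (-δ)
      = (1 + T) ^ (-δ) * Φ T - ∫ t in (0 : ℝ)..T, -δ * (1 + t) ^ (-δ - 1) * Φ t := by
    rw [← hib]
    simp only [mul_comm]
  have e2 : (1 + T) ^ (-δ) * Φ T ≤ C := by
    calc (1 + T) ^ (-δ) * Φ T ≤ (1 + T) ^ (-δ) * (C * T ^ e) := by
          gcongr
          exact h T hT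
      _ = C * T ^ e * (1 + T) ^ (-δ) := by ring
      _ ≤ C * (1 + T) ^ (e + -δ) := hbd _ _ hT
      _ ≤ C * 1 := by
          gcongr
          exact Real.rpow_le_one_of_one_le_of_nonpos (by linarith) (by linarith)
      _ = C := mul_one C
  have e3 : ∫ t in (0 : ℝ)..T, (1 + t) ^ (-δ - 1) * Φ t ≤ C * (1 / (δ - e)) := by
    calc ∫ t in (0 : ℝ)..T, (1 + t) ^ (-δ - 1) * Φ t
        ≤ ∫ t in (0 : ℝ)..T, C * (1 + t) ^ (-(δ - e) - 1) := by
          refine integral_mono_on hT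
            ((continuousOn_one_add_rpow _ hT).mul hcΦ.continuousOn).intervalIntegrable
            (continuousOn_const.mul (continuousOn_one_add_rpow _ hT)).intervalIntegrable
            fun t ht => ?_
          have h1 := hbd (-δ - 1) t ht.1
          have h2 : e + (-δ - 1) = -(δ - e) - 1 := by ring
          rw [h2] at h1
          refine le_trans ?_ h1
          rw [mul_comm]
          have h3 : 0 ≤ (1 + t) ^ (-δ - 1) := Real.rpow_nonneg (by linarith [ht.1]) _
          gcongr
          exact h t ht.1
      _ ≤ _ := by
          rw [intervalIntegral.integral_const_mul]
          gcongr
          exact integral_one_add_rpow_le hde hT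
  have e4 : ∫ t in (0 : ℝ)..T, -δ * (1 + t) ^ (-δ - 1) * Φ t
      = -δ * ∫ t in (0 : ℝ)..T, (1 + t) ^ (-δ - 1) * Φ t := by
    rw [← intervalIntegral.integral_const_mul]
    simp only [mul_assoc]
  rw [e1, e4]
  have e5 := mul_le_mul_of_nonneg_left e3 (by linarith : 0 ≤ δ)
  calc _ ≤ C + δ * (C * (1 / (δ - e))) := by linarith
    _ = _ := by ring

theorem exists_integral_norm_bes_mul_le {δ : ℝ} (hδ : 0 < δ) :
    ∃ C, 0 ≤ C ∧ ∀ (a b : ℤ) (T : ℝ), 0 ≤ T →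
      ∫ t in (0 : ℝ)..T, ‖bes a t‖ * ‖bes b t‖ * (1 + t) ^ (-δ) ≤ C := by
  obtain ⟨e, he0, he1, hed⟩ : ∃ e : ℝ, 0 < e ∧ e ≤ 1 ∧ e < δ :=
    ⟨min (δ / 2) 1, by positivity, min_le_right _ _, (min_le_left _ _).trans_lt (by linarith)⟩
  obtain ⟨C, hC, h⟩ := exists_integral_norm_sq_bes_le he0 he1
  have hde : 0 < δ - e := by linarith
  refine ⟨C * (1 + δ / (δ - e)), by positivity, fun a b T hT => ?_⟩
  have hc : ∀ a, Continuous fun t => ‖bes a t‖ ^ 2 := fun a => (continuous_bes a).norm.pow 2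
  have hca : ∀ a, IntervalIntegrable (fun t => ‖bes a t‖ ^ 2 * (1 + t) ^ (-δ)) volume 0 T :=
    fun a => ((hc a).continuousOn.mul (continuousOn_one_add_rpow _ hT)).intervalIntegrable
  have h1 : ∀ a, ∫ t in (0 : ℝ)..T, ‖bes a t‖ ^ 2 * (1 + t) ^ (-δ) ≤ C * (1 + δ / (δ - e)) :=
    fun a => integral_mul_rpow_neg_le (hc a) hC he0.le hed (h a) hT
  -- The inequality `xy ≤ (x² + y²)/2` reduces to equal indices.
  calc ∫ t in (0 : ℝ)..T, ‖bes a t‖ * ‖bes b t‖ * (1 + t) ^ (-δ)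
      ≤ ∫ t in (0 : ℝ)..T, (1 / 2 : ℝ) *
          (‖bes a t‖ ^ 2 * (1 + t) ^ (-δ) + ‖bes b t‖ ^ 2 * (1 + t) ^ (-δ)) := by
        refine integral_mono_on hT (ContinuousOn.intervalIntegrable ?_)
          (((hca a).add (hca b)).const_mul _) fun t ht => ?_
        · exact ((continuous_bes a).norm.mul (continuous_bes b).norm).continuousOn.mul
            (continuousOn_one_add_rpow _ hT)
        · have h3 : 0 ≤ (1 + t) ^ (-δ) := Real.rpow_nonneg (by linarith [ht.1]) _
          nlinarith [mul_nonneg (sq_nonneg (‖bes a t‖ - ‖bes b t‖)) h3]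
    _ ≤ _ := by
        rw [intervalIntegral.integral_const_mul, intervalIntegral.integral_add (hca a) (hca b)]
        linarith [h1 a, h1 b]

theorem exists_norm_bes_le_abs : ∃ C, 0 ≤ C ∧ ∀ (a : ℤ) (t : ℝ),
    ‖bes a t‖ ≤ C * (1 + |(a : ℝ)|) * (1 + |t|) ^ (-(1 / 8) : ℝ) := by
  obtain ⟨C, hC, h⟩ := exists_norm_bes_le
  refine ⟨C, hC, fun a t => ?_⟩
  rcases le_total 0 t with ht | ht
  · rw [abs_of_nonneg ht]
    exact h a t ht
  · have h1 := h (-a) (-t) (by linarith)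
    rw [norm_bes_neg, neg_neg, Int.cast_neg, abs_neg] at h1
    rwa [abs_of_nonpos ht]

/-! ### Decay of the weighted one-dimensional propagator. -/

theorem coordMul_add {d : ℕ} (j : Fin d) {u v w : ℤ → ℂ} {K L M : ℝ} (hu : ∀ k, ‖u k‖ ≤ K)
    (hv : ∀ k, ‖v k‖ ≤ L) (hw : ∀ k, ‖w k‖ ≤ M) (h : ∀ k, w k = u k + v k) :
    coordMul j w = coordMul j u + coordMul j v :=
  Op.ext fun f n => by
    rw [coordMul_apply j hw, h, add_mul, ← coordMul_apply j hu, ← coordMul_apply j hv]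
    rfl

theorem coordMul_eq_sum {d : ℕ} (j : Fin d) (s : Finset ℤ) {u : ℤ → ℂ} {K : ℝ}
    (hu : ∀ k, ‖u k‖ ≤ K) (hs : ∀ k, k ∉ s → u k = 0) :
    coordMul j u = ∑ k ∈ s, u k • proj j k :=
  Op.ext fun f n => by
    have h1 : (∑ k ∈ s, u k • proj j k) f n = ∑ k ∈ s, u k * proj j k f n := by
      rw [sum_apply, lp.coeFn_sum, Finset.sum_apply]
      rfl
    rw [coordMul_apply j hu, h1]
    simp only [proj_apply, mul_ite, mul_zero, Finset.sum_ite_eq]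
    split_ifs with h
    · rfl
    · rw [hs _ h, zero_mul]

theorem norm_coordMul_prop_coordMul_le {d : ℕ} (j : Fin d) (s : Finset ℤ) {u : ℤ → ℂ}
    (hu : ∀ k, ‖u k‖ ≤ 1) (hs : ∀ k, k ∉ s → u k = 0) (t : ℝ) {B : ℝ}
    (hB : ∀ k ∈ s, ∀ l ∈ s, ‖bes (k - l) t‖ ≤ B) :
    ‖coordMul j u * prop (h0 j) t * coordMul j u‖ ≤ s.card ^ 2 * B := by
  have h1 : coordMul j u * prop (h0 j) t * coordMul j u
      = ∑ k ∈ s, ∑ l ∈ s, (u k * u l) • (proj j k * prop (h0 j) t * proj j l) := by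
    rw [coordMul_eq_sum j s hu hs, Finset.sum_mul, Finset.sum_mul]
    refine Finset.sum_congr rfl fun k _ => ?_
    rw [Finset.mul_sum]
    refine Finset.sum_congr rfl fun l _ => ?_
    rw [smul_mul_assoc, smul_mul_assoc, mul_smul_comm, smul_smul]
  rw [h1]
  calc _ ≤ ∑ k ∈ s, ∑ l ∈ s, B := by
        refine norm_sum_le_of_le _ fun k hk => norm_sum_le_of_le _ fun l hl => ?_
        rw [norm_smul, norm_mul]
        refine (mul_le_of_le_one_left (norm_nonneg _)
          (mul_le_one₀ (hu k) (norm_nonneg _) (hu l))).trans ?_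
        exact (norm_proj_mul_prop_h0_mul_proj_le j t k l).trans (hB k hk l hl)
    _ = _ := by
        simp only [Finset.sum_const, nsmul_eq_mul]
        ring

/-- Polynomial decay of the one-dimensional propagator between decaying weights. -/
theorem exists_norm_weight_prop_weight_le {s : ℝ} (hs0 : 0 < s) (hs1 : s ≤ 1) :
    ∃ C, 0 ≤ C ∧ ∀ (d : ℕ) (j : Fin d) (w : ℤ → ℂ), (∀ k, ‖w k‖ ≤ (1 + (k : ℝ) ^ 2) ^ (-s / 2)) →
      ∀ t : ℝ, ‖coordMul j w * prop (h0 j) t * coordMul j w‖ ≤ C * (1 + |t|) ^ (-(s / 32)) := by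
  obtain ⟨C, hC, hbes⟩ := exists_norm_bes_le_abs
  refine ⟨27 * C + 2, by positivity, fun d j w hw t => ?_⟩
  have ht : 1 ≤ 1 + |t| := by linarith [abs_nonneg t]
  -- Cutoff radius. Inside there are at most `(3x)²` entries, each at most `C (3x) x⁻⁴`, hence `27 C
  -- x⁻¹` in total; outside, the weight is at most `x^(-s)`. The hypothesis `s ≤ 1` makes the latter
  -- the larger power.
  set x := (1 + |t|) ^ (1 / 32 : ℝ) with hx
  have hx1 : 1 ≤ x := Real.one_le_rpow ht (by norm_num)
  have hx0 : 0 < x := by linarith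
  have hxs : (1 + |t|) ^ (-(s / 32)) = x ^ (-s) := by
    rw [hx, ← Real.rpow_mul (by linarith)]
    congr 1
    ring
  have hx8 : (1 + |t|) ^ (-(1 / 8) : ℝ) = (x ^ 4)⁻¹ := by
    rw [hx, ← Real.rpow_natCast, ← Real.rpow_mul (by linarith), ← Real.rpow_neg (by linarith)]
    norm_num
  set N := ⌊x⌋₊ with hN
  have hN1 : (N : ℝ) ≤ x := Nat.floor_le hx0.le
  have hN2 : x ≤ N + 1 := (Nat.lt_floor_add_one x).le
  have hw1 : ∀ k, ‖w k‖ ≤ 1 := fun k => (hw k).trans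
    (Real.rpow_le_one_of_one_le_of_nonpos (by linarith [sq_nonneg (k : ℝ)]) (by linarith))
  set u : ℤ → ℂ := fun k => if k ∈ Finset.Icc (-N : ℤ) N then w k else 0 with hu
  set v : ℤ → ℂ := fun k => if k ∈ Finset.Icc (-N : ℤ) N then 0 else w k with hv
  have hu1 : ∀ k, ‖u k‖ ≤ 1 := fun k => by
    simp only [hu]
    split_ifs
    · exact hw1 k
    · simp
  have hv1 : ∀ k, ‖v k‖ ≤ x ^ (-s) := fun k => by
    simp only [hv]
    split_ifs with h
    · simpa using Real.rpow_nonneg hx0.le _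
    · refine (hw k).trans ?_
      -- Integrality of `k` gives `|k| ≥ N + 1`, hence `|k| ≥ x`.
      have h1 : (N : ℤ) + 1 ≤ |k| := by
        rw [Finset.mem_Icc, ← abs_le] at h
        omega
      have h2 : (N : ℝ) + 1 ≤ |(k : ℝ)| := by exact_mod_cast h1
      have h3 : x ^ 2 ≤ 1 + (k : ℝ) ^ 2 := by
        rw [← sq_abs (k : ℝ)]
        nlinarith
      calc (1 + (k : ℝ) ^ 2) ^ (-s / 2) ≤ (x ^ 2) ^ (-s / 2) :=
            Real.rpow_le_rpow_of_nonpos (by positivity) h3 (by linarith)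
        _ = x ^ (-s) := by
            rw [← Real.rpow_natCast, ← Real.rpow_mul hx0.le]
            congr 1
            push_cast
            ring
  have hadd := coordMul_add j hu1 hv1 hw1 fun k => by
    simp only [hu, hv]
    split_ifs <;> simp
  have hE := norm_prop_le (isSelfAdjoint_h0 j) t
  have hcu := norm_coordMul_le j hu1
  have hcv := norm_coordMul_le j hv1
  have hcw := norm_coordMul_le j hw1
  have hmain := norm_coordMul_prop_coordMul_le j (Finset.Icc (-N : ℤ) N) hu1
    (fun k hk => if_neg hk) t (B := C * (3 * x) * (x ^ 4)⁻¹) fun k hk l hl => by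
      refine (hbes (k - l) t).trans ?_
      rw [hx8]
      gcongr
      have h1 : |k - l| ≤ 2 * N := by
        rw [Finset.mem_Icc] at hk hl
        rw [abs_le]
        omega
      have h2 : |((k - l : ℤ) : ℝ)| ≤ 2 * N := by exact_mod_cast h1
      linarith
  have hcard : ((Finset.Icc (-N : ℤ) N).card : ℝ) ≤ 3 * x := by
    rw [Int.card_Icc]
    have h1 : ((N : ℤ) + 1 - -N).toNat = 2 * N + 1 := by omega
    rw [h1]
    push_cast
    linarith
  have hmain2 : ‖coordMul j u * prop (h0 j) t * coordMul j u‖ ≤ 27 * C * x ^ (-s) := by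
    refine hmain.trans ?_
    calc _ ≤ (3 * x) ^ 2 * (C * (3 * x) * (x ^ 4)⁻¹) := by gcongr
      _ = 27 * C * x⁻¹ := by
          field_simp
          ring
      _ ≤ 27 * C * x ^ (-s) := by
          gcongr
          rw [← Real.rpow_neg_one]
          exact Real.rpow_le_rpow_of_exponent_le hx1 (by linarith)
  have hsplit : coordMul j w * prop (h0 j) t * coordMul j w
      = coordMul j u * prop (h0 j) t * coordMul j u + (coordMul j u * prop (h0 j) t * coordMul j v
        + coordMul j v * prop (h0 j) t * coordMul j w) := by
    rw [hadd]
    noncomm_ring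
  have hx0s : 0 ≤ x ^ (-s) := by positivity
  have h3 : ‖coordMul j u * prop (h0 j) t * coordMul j v‖ ≤ 1 * 1 * x ^ (-s) :=
    norm_mul_le_of_le (norm_mul_le_of_le hcu hE) hcv
  have h4 : ‖coordMul j v * prop (h0 j) t * coordMul j w‖ ≤ x ^ (-s) * 1 * 1 :=
    norm_mul_le_of_le (norm_mul_le_of_le hcv hE) hcw
  rw [hsplit, hxs]
  refine (norm_add_le _ _).trans ((add_le_add hmain2 (norm_add_le _ _)).trans ?_)
  linarith

/-! ### Factorisation of the propagator over the coordinates. -/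

/-- Operators on different coordinates commute, so each propagator can be placed between its own
pair of weights; `r` collects the unweighted coordinates. -/
theorem mul_rearrange {M : Type*} [Monoid M] {p q w a b c r w' q' p' : M}
    (hrw : Commute r w') (hrq : Commute r q') (hrp : Commute r p') (hwa : Commute w a)
    (hwb : Commute w b) (hqa : Commute q a) (hqp : Commute q' p') (hwp : Commute w' p')
    (hcp : Commute c p') (hwp' : Commute w p') (hbp : Commute b p') (hqp' : Commute q p')
    (hwq : Commute w' q') (hcq : Commute c q') (hwq' : Commute w q') :
    p * q * w * (a * b * c * r) * w' * q' * p'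
      = p * a * p' * (q * b * q') * (w * c * w') * r := by
  simp only [mul_assoc]
  rw [hrw.left_comm, hrq.left_comm, hrp.eq, hwa.left_comm, hwb.left_comm, hqa.left_comm,
    hqp.left_comm, hwp.left_comm, hcp.left_comm, hwp'.left_comm, hbp.left_comm, hqp'.left_comm,
    hwq.left_comm, hcq.left_comm, hwq'.left_comm]

theorem norm_block_prop_le {d : ℕ} {i₁ i₂ i₃ : Fin d} (h12 : i₁ ≠ i₂) (h13 : i₁ ≠ i₃)
    (h23 : i₂ ≠ i₃) {w : ℤ → ℂ} {K : ℝ} (hw : ∀ k, ‖w k‖ ≤ K) (t : ℝ) (k₁ k₂ l₁ l₂ : ℤ) :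
    ‖proj i₁ k₁ * proj i₂ k₂ * coordMul i₃ w * prop (H0 d) t * coordMul i₃ w * proj i₂ l₂ *
      proj i₁ l₁‖ ≤ ‖bes (k₁ - l₁) t‖ * ‖bes (k₂ - l₂) t‖ *
        ‖coordMul i₃ w * prop (h0 i₃) t * coordMul i₃ w‖ := by
  set s : Finset (Fin d) := ((Finset.univ.erase i₁).erase i₂).erase i₃ with hs
  set Hr : Op d := ∑ j ∈ s, h0 j with hHr
  have hH : H0 d = h0 i₁ + h0 i₂ + h0 i₃ + Hr := by
    rw [H0_eq_sum, ← Finset.add_sum_erase _ _ (Finset.mem_univ i₁),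
      ← Finset.add_sum_erase _ _ (Finset.mem_erase.2 ⟨h12.symm, Finset.mem_univ i₂⟩),
      ← Finset.add_sum_erase _ _ (Finset.mem_erase.2 ⟨h23.symm,
        Finset.mem_erase.2 ⟨h13.symm, Finset.mem_univ i₃⟩⟩), add_assoc, add_assoc]
  have hcr : ∀ i, Commute (h0 i) Hr := fun i =>
    Commute.sum_right _ _ _ fun j _ => commute_h0 i j
  have hsa : IsSelfAdjoint Hr := isSelfAdjoint_sum _ fun j _ => isSelfAdjoint_h0 j
  have hE : prop (H0 d) t = prop (h0 i₁) t * prop (h0 i₂) t * prop (h0 i₃) t * prop Hr t := by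
    rw [hH, prop_add (((hcr _).add_left (hcr _)).add_left (hcr _)),
      prop_add ((commute_h0 _ _).add_left (commute_h0 _ _)), prop_add (commute_h0 _ _)]
  have hmem : ∀ j ∈ s, i₁ ≠ j ∧ i₂ ≠ j ∧ i₃ ≠ j := fun j hj => by
    simp only [hs, Finset.mem_erase] at hj
    exact ⟨hj.2.2.1.symm, hj.2.1.symm, hj.1.symm⟩
  have hcoord : ∀ (i : Fin d) (u : ℤ → ℂ) (L : ℝ), (∀ k, ‖u k‖ ≤ L) → (∀ j ∈ s, i ≠ j) →
      Commute (prop Hr t) (coordMul i u) := fun i u L hu hi =>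
    (commute_prop (Commute.sum_right _ _ _ fun j hj => commute_coordMul_h0 (hi j hj) hu) t).symm
  have hpr : ∀ {i j : Fin d}, i ≠ j → ∀ {u : ℤ → ℂ} {L : ℝ}, (∀ k, ‖u k‖ ≤ L) →
      Commute (coordMul i u) (prop (h0 j) t) := fun hij _ _ hu =>
    commute_prop (commute_coordMul_h0 hij hu) t
  have hI := norm_ind_le
  rw [hE, mul_rearrange (p := proj i₁ k₁) (q := proj i₂ k₂) (q' := proj i₂ l₂) (p' := proj i₁ l₁)
    (hcoord _ _ _ hw fun j hj => (hmem j hj).2.2)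
    (hcoord _ _ _ (hI l₂) fun j hj => (hmem j hj).2.1)
    (hcoord _ _ _ (hI l₁) fun j hj => (hmem j hj).1)
    (hpr h13.symm hw) (hpr h23.symm hw) (hpr h12.symm (hI k₂))
    (commute_coordMul _ _ (hI l₂) (hI l₁)) (commute_coordMul _ _ hw (hI l₁))
    (hpr h13 (hI l₁)).symm (commute_coordMul _ _ hw (hI l₁)) (hpr h12 (hI l₁)).symm
    (commute_coordMul _ _ (hI k₂) (hI l₁)) (commute_coordMul _ _ hw (hI l₂))
    (hpr h23 (hI l₂)).symm (commute_coordMul _ _ hw (hI l₂))]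
  have h1 := norm_proj_mul_prop_h0_mul_proj_le i₁ t k₁ l₁
  have h2 := norm_proj_mul_prop_h0_mul_proj_le i₂ t k₂ l₂
  have h3 := norm_mul_le_of_le (norm_mul_le_of_le (norm_mul_le_of_le h1 h2)
    (le_refl ‖coordMul i₃ w * prop (h0 i₃) t * coordMul i₃ w‖)) (norm_prop_le hsa t)
  rwa [mul_one] at h3

/-! ### The resolvent and its time representation. -/

theorem Op.real_smul {d : ℕ} (r : ℝ) (A : Op d) : r • A = (r : ℂ) • A :=
  RCLike.real_smul_eq_coe_smul (K := ℂ) r A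

theorem isSelfAdjoint_H0 (d : ℕ) : IsSelfAdjoint (H0 d) := by
  rw [H0_eq_sum]
  exact isSelfAdjoint_sum _ fun j _ => isSelfAdjoint_h0 j

theorem norm_H0_sub_le (d : ℕ) : ‖H0 d - algebraMap ℂ (Op d) (d / 2)‖ ≤ d / 2 := by
  have h1 : H0 d - algebraMap ℂ (Op d) (d / 2)
      = -((1 / 4 : ℂ) • ∑ j : Fin d, (shift (Pi.single j 1) + shift (-Pi.single j 1))) := by
    rw [H0, Algebra.algebraMap_eq_smul_one]
    exact sub_sub_cancel_left _ _
  rw [h1, norm_neg, norm_smul]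
  have h2 : ‖∑ j : Fin d, (shift (Pi.single j 1) + shift (-Pi.single j 1))‖
      ≤ ∑ _j : Fin d, (2 : ℝ) := norm_sum_le_of_le _ fun j _ =>
    (norm_add_le_of_le (norm_shift_le _) (norm_shift_le _)).trans_eq one_add_one_eq_two
  rw [Finset.sum_const, Finset.card_univ, Fintype.card_fin, nsmul_eq_mul] at h2
  have h3 : ‖(1 / 4 : ℂ)‖ = 1 / 4 := by simp
  rw [h3]
  linarith

/-- Self-adjointness makes the spectrum real, and `‖H₀ - d/2‖ ≤ d/2` confines it to `[0, d]`. -/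
theorem isUnit_H0_sub {d : ℕ} {z : ℂ} (hz : z ∈ Lam d) :
    IsUnit (H0 d - z • ContinuousLinearMap.id ℂ (L2Zd d)) := by
  by_contra hu
  have e1 : H0 d - z • ContinuousLinearMap.id ℂ (L2Zd d) = -(algebraMap ℂ (Op d) z - H0 d) := by
    rw [neg_sub, Algebra.algebraMap_eq_smul_one]
    rfl
  rw [e1, IsUnit.neg_iff] at hu
  have h1 : z = z.re := (isSelfAdjoint_H0 d).mem_spectrum_eq_re hu
  have e2 : algebraMap ℂ (Op d) z - H0 d
      = algebraMap ℂ (Op d) (z - d / 2) - (H0 d - algebraMap ℂ (Op d) (d / 2)) := by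
    rw [map_sub]
    abel
  rw [e2] at hu
  have h2 : ‖z - d / 2‖ ≤ d / 2 := by
    refine (spectrum.norm_le_norm_mul_of_mem (𝕜 := ℂ) hu).trans ?_
    refine (mul_le_mul (norm_H0_sub_le d) ContinuousLinearMap.norm_id_le (norm_nonneg _)
      (by positivity)).trans_eq (mul_one _)
  have h3 : |z.re - d / 2| ≤ d / 2 := by
    have := (Complex.abs_re_le_norm (z - d / 2)).trans h2
    simpa using this
  rw [abs_le] at h3
  exact hz ⟨z.re, ⟨by linarith, by linarith⟩, h1.symm⟩

theorem mem_Lam_of_im_ne_zero {d : ℕ} {z : ℂ} (hz : z.im ≠ 0) : z ∈ Lam d := by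
  rintro ⟨x, -, rfl⟩
  exact hz (Complex.ofReal_im x)

theorem R0_mul_sub {d : ℕ} {z : ℂ} (hz : z ∈ Lam d) :
    R0 d z * (H0 d - z • (1 : Op d)) = 1 :=
  Ring.inverse_mul_cancel _ (isUnit_H0_sub hz)

theorem hasDerivAt_prop {d : ℕ} (A : Op d) (t : ℝ) :
    HasDerivAt (prop A) ((-Complex.I) • (A * prop A t)) t := by
  have h1 : ∀ u : ℝ, prop A u = NormedSpace.exp (u • ((-Complex.I) • A)) := fun u => by
    rw [prop, Op.real_smul, smul_smul, neg_mul, mul_neg]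
  have h2 : HasDerivAt (fun u : ℝ => NormedSpace.exp (u • ((-Complex.I) • A)))
      (((-Complex.I) • A) * NormedSpace.exp (t • ((-Complex.I) • A))) t :=
    hasDerivAt_exp_smul_const' ((-Complex.I) • A) t
  rw [← h1, smul_mul_assoc] at h2
  exact h2.congr_of_eventuallyEq (Eventually.of_forall h1)

theorem continuous_prop {d : ℕ} (A : Op d) : Continuous (prop A) :=
  continuous_iff_continuousAt.2 fun t => (hasDerivAt_prop A t).continuousAt

/-- The scalar factor `exp (iσtz)`. -/
noncomputable def phase (σ : ℝ) (z : ℂ) (t : ℝ) : ℂ := Complex.exp (t * (σ * z * Complex.I))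

theorem continuous_phase (σ : ℝ) (z : ℂ) : Continuous (phase σ z) := by
  unfold phase
  fun_prop

theorem norm_phase (σ : ℝ) (z : ℂ) (t : ℝ) : ‖phase σ z t‖ = Real.exp (-(σ * z.im * t)) := by
  rw [phase, Complex.norm_exp]
  congr 1
  simp
  ring

/-- Differentiation produces `H₀ - z`, which cancels the resolvent. The function equals `A R₀(z) B`
at `t = 0` while its derivative involves only the propagator; `σ = ±1` chooses the direction of
time. -/
theorem hasDerivAt_R0_mul_prop {d : ℕ} {z : ℂ} (hz : z ∈ Lam d) (σ : ℝ) (A B : Op d) (t : ℝ) :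
    HasDerivAt (fun t : ℝ => A * (R0 d z * (phase σ z t • prop (H0 d) (σ * t))) * B)
      ((-(σ * Complex.I) * phase σ z t) • (A * prop (H0 d) (σ * t) * B)) t := by
  have h1 : HasDerivAt (phase σ z) (phase σ z t * (1 * (σ * z * Complex.I))) t :=
    (((hasDerivAt_id t).ofReal_comp).mul_const _).cexp
  have h2 : HasDerivAt (fun t : ℝ => prop (H0 d) (σ * t))
      ((σ * 1) • ((-Complex.I) • (H0 d * prop (H0 d) (σ * t)))) t :=
    (hasDerivAt_prop (H0 d) (σ * t)).scomp t ((hasDerivAt_id t).const_mul σ)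
  have h3 := (((h1.smul h2).const_mul (R0 d z)).const_mul A).mul_const B
  refine h3.congr_deriv ?_
  have e1 : phase σ z t • ((σ * 1) • ((-Complex.I) • (H0 d * prop (H0 d) (σ * t))))
      + (phase σ z t * (1 * (σ * z * Complex.I))) • prop (H0 d) (σ * t)
      = (-(σ * Complex.I) * phase σ z t) •
        ((H0 d - z • (1 : Op d)) * prop (H0 d) (σ * t)) := by
    rw [Op.real_smul, sub_mul, smul_mul_assoc, one_mul, smul_sub, smul_smul, smul_smul,
      smul_smul, sub_eq_add_neg, ← neg_smul]
    congr 2 <;> push_cast <;> ring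
  rw [e1, mul_smul_comm, ← mul_assoc (R0 d z), R0_mul_sub hz, one_mul, mul_smul_comm,
    smul_mul_assoc]

/-- The fundamental theorem of calculus on `[0, T]`, then `T → ∞`. Uniform bounds on truncated
integrals suffice, so no improper operator integral is formed. -/
theorem norm_le_of_deriv_le {E : Type*} [NormedAddCommGroup E] [NormedSpace ℝ E] [CompleteSpace E]
    {f f' : ℝ → E} (hf : ∀ t, HasDerivAt f (f' t) t) (hf' : Continuous f')
    (h0 : Tendsto f atTop (𝓝 0)) {F : ℝ → ℝ} {K : ℝ} (hF : ∀ t, 0 ≤ t → ‖f' t‖ ≤ F t)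
    (hint : ∀ T, 0 ≤ T → IntervalIntegrable F volume 0 T)
    (hK : ∀ T, 0 ≤ T → ∫ t in (0 : ℝ)..T, F t ≤ K) : ‖f 0‖ ≤ K := by
  have h1 : ∀ T, 0 ≤ T → ‖f 0‖ ≤ ‖f T‖ + K := fun T hT => by
    have h2 := integral_eq_sub_of_hasDerivAt (a := 0) (b := T) (fun t _ => hf t)
      (hf'.intervalIntegrable _ _)
    have h3 := norm_integral_le_of_norm_le hT (Eventually.of_forall fun t ht => hF t ht.1.le)
      (hint T hT)
    rw [h2] at h3
    have h4 : f 0 = f T - (f T - f 0) := by abel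
    rw [h4]
    refine (norm_sub_le _ _).trans ?_
    gcongr
    exact h3.trans (hK T hT)
  have h5 : Tendsto (fun T => ‖f T‖ + K) atTop (𝓝 (0 + K)) := by
    have := h0.norm
    rw [norm_zero] at this
    exact this.add_const K
  rw [zero_add] at h5
  exact ge_of_tendsto h5 ((eventually_ge_atTop 0).mono h1)

theorem tendsto_R0_mul_prop {d : ℕ} {z : ℂ} {σ : ℝ} (hσ : 0 < σ * z.im) (A B : Op d) :
    Tendsto (fun t : ℝ => A * (R0 d z * (phase σ z t • prop (H0 d) (σ * t))) * B) atTop (𝓝 0) := by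
  refine squeeze_zero_norm (a := fun t => ‖A‖ * (‖R0 d z‖ * Real.exp (-(σ * z.im * t))) * ‖B‖)
    (fun t => ?_) ?_
  · have h1 : ‖phase σ z t • prop (H0 d) (σ * t)‖ ≤ Real.exp (-(σ * z.im * t)) := by
      rw [norm_smul, norm_phase]
      exact mul_le_of_le_one_right (Real.exp_pos _).le (norm_prop_le (isSelfAdjoint_H0 d) _)
    exact norm_mul_le_of_le (norm_mul_le_of_le le_rfl (norm_mul_le_of_le le_rfl h1)) le_rfl
  · have h1 : Tendsto (fun t : ℝ => Real.exp (-(σ * z.im * t))) atTop (𝓝 0) :=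
      Real.tendsto_exp_neg_atTop_nhds_zero.comp (tendsto_id.const_mul_atTop hσ)
    simpa using ((h1.const_mul ‖R0 d z‖).const_mul ‖A‖).mul_const ‖B‖

/-- Mean value inequality on the convex left half-plane, where the derivative of `exp` has modulus
at most one. -/
theorem norm_exp_sub_exp_le {u v : ℂ} (hu : u.re ≤ 0) (hv : v.re ≤ 0) :
    ‖Complex.exp u - Complex.exp v‖ ≤ ‖u - v‖ := by
  have h := Convex.norm_image_sub_le_of_norm_deriv_le (𝕜 := ℂ) (f := Complex.exp) (C := 1)
    (s := {w : ℂ | w.re ≤ 0}) (fun x _ => Complex.differentiableAt_exp)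
    (fun x hx => by
      rw [Complex.deriv_exp, Complex.norm_exp]
      exact Real.exp_le_one_iff.2 hx) (convex_halfSpace_re_le 0) hv hu
  rwa [one_mul] at h

/-- Interpolation between the bounds `2` and `‖z - z₁‖ t`. -/
theorem norm_phase_sub_le {σ : ℝ} (hσ : |σ| = 1) {z z₁ : ℂ} (hz : 0 ≤ σ * z.im)
    (hz₁ : 0 ≤ σ * z₁.im) {g : ℝ} (hg0 : 0 ≤ g) (hg1 : g ≤ 1) {t : ℝ} (ht : 0 ≤ t) :
    ‖phase σ z t - phase σ z₁ t‖ ≤ 2 * ‖z - z₁‖ ^ g * t ^ g := by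
  have h1 : ∀ w : ℂ, 0 ≤ σ * w.im → ‖phase σ w t‖ ≤ 1 := fun w hw => by
    rw [norm_phase]
    exact Real.exp_le_one_iff.2 (neg_nonpos.2 (mul_nonneg hw ht))
  have h2 : ‖phase σ z t - phase σ z₁ t‖ ≤ 2 :=
    (norm_sub_le _ _).trans (by linarith [h1 z hz, h1 z₁ hz₁])
  have hre : ∀ w : ℂ, 0 ≤ σ * w.im → (t * (σ * w * Complex.I) : ℂ).re ≤ 0 := fun w hw => by
    have := mul_nonneg hw ht
    simp
    linarith
  have h3 : ‖phase σ z t - phase σ z₁ t‖ ≤ ‖z - z₁‖ * t := by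
    refine (norm_exp_sub_exp_le (hre z hz) (hre z₁ hz₁)).trans_eq ?_
    rw [← mul_sub, ← sub_mul, ← mul_sub, norm_mul, norm_mul, norm_mul, Complex.norm_I,
      Complex.norm_real, Complex.norm_real, Real.norm_of_nonneg ht, Real.norm_eq_abs, hσ]
    ring
  have h0 := norm_nonneg (phase σ z t - phase σ z₁ t)
  calc _ = ‖phase σ z t - phase σ z₁ t‖ ^ (1 - g) * ‖phase σ z t - phase σ z₁ t‖ ^ g := by
        rw [← Real.rpow_add_of_nonneg h0 (by linarith) hg0]
        simp
    _ ≤ 2 ^ (1 - g) * (‖z - z₁‖ * t) ^ g := by gcongr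
    _ ≤ 2 ^ (1 : ℝ) * (‖z - z₁‖ * t) ^ g := by
        gcongr
        · norm_num
        · linarith
    _ = _ := by
        rw [Real.mul_rpow (norm_nonneg _) ht, Real.rpow_one]
        ring

/-- A time-integrable bound on `A exp (-iσtH₀) B` bounds `A R₀(z) B`. -/
theorem norm_mul_R0_mul_le {d : ℕ} {σ : ℝ} (hσ : |σ| = 1) {z : ℂ} (hz : 0 < σ * z.im)
    (A B : Op d) {F : ℝ → ℝ} {K : ℝ} (hF : ∀ t, 0 ≤ t → ‖A * prop (H0 d) (σ * t) * B‖ ≤ F t)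
    (hint : ∀ T, 0 ≤ T → IntervalIntegrable F volume 0 T)
    (hK : ∀ T, 0 ≤ T → ∫ t in (0 : ℝ)..T, F t ≤ K) : ‖A * R0 d z * B‖ ≤ K := by
  have hzL : z ∈ Lam d := mem_Lam_of_im_ne_zero fun h => by simp [h] at hz
  have hc := continuous_prop (H0 d)
  have hp := continuous_phase σ z
  have h := norm_le_of_deriv_le (hasDerivAt_R0_mul_prop hzL σ A B) (by fun_prop)
    (tendsto_R0_mul_prop hz A B) (F := F) (K := K) (fun t ht => ?_) hint hK
  · simpa [phase, prop, mul_assoc] using h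
  · rw [norm_smul, norm_mul, norm_neg, norm_mul, Complex.norm_I, Complex.norm_real,
      Real.norm_eq_abs, hσ, mul_one, one_mul, norm_phase]
    refine (mul_le_of_le_one_left (norm_nonneg _) ?_).trans (hF t ht)
    exact Real.exp_le_one_iff.2 (neg_nonpos.2 (mul_nonneg hz.le ht))

theorem norm_mul_R0_sub_mul_le {d : ℕ} {σ : ℝ} (hσ : |σ| = 1) {z z₁ : ℂ} (hz : 0 < σ * z.im)
    (hz₁ : 0 < σ * z₁.im) {g : ℝ} (hg0 : 0 ≤ g) (hg1 : g ≤ 1)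
    (A B : Op d) {F : ℝ → ℝ} {K : ℝ}
    (hF : ∀ t, 0 ≤ t → t ^ g * ‖A * prop (H0 d) (σ * t) * B‖ ≤ F t)
    (hint : ∀ T, 0 ≤ T → IntervalIntegrable F volume 0 T)
    (hK : ∀ T, 0 ≤ T → ∫ t in (0 : ℝ)..T, F t ≤ K) :
    ‖A * (R0 d z - R0 d z₁) * B‖ ≤ 2 * ‖z - z₁‖ ^ g * K := by
  have hL : ∀ w : ℂ, 0 < σ * w.im → w ∈ Lam d := fun w hw =>
    mem_Lam_of_im_ne_zero fun h => by simp [h] at hw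
  have hc := continuous_prop (H0 d)
  have hp := continuous_phase σ z
  have hp₁ := continuous_phase σ z₁
  have h := norm_le_of_deriv_le (F := fun t => 2 * ‖z - z₁‖ ^ g * F t)
    (K := 2 * ‖z - z₁‖ ^ g * K) (fun t => (hasDerivAt_R0_mul_prop (hL z hz) σ A B t).sub
      (hasDerivAt_R0_mul_prop (hL z₁ hz₁) σ A B t)) (by fun_prop)
    (by
      have h := (tendsto_R0_mul_prop hz A B).sub (tendsto_R0_mul_prop hz₁ A B)
      rwa [sub_zero] at h)
    (fun t ht => ?_) (fun T hT => (hint T hT).const_mul _) (fun T hT => ?_)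
  · simpa [phase, prop, mul_assoc, mul_sub, sub_mul] using h
  · rw [← sub_smul, ← mul_sub, norm_smul, norm_mul, norm_neg, norm_mul, Complex.norm_I,
      Complex.norm_real, Real.norm_eq_abs, hσ, mul_one, one_mul]
    calc _ ≤ 2 * ‖z - z₁‖ ^ g * t ^ g * ‖A * prop (H0 d) (σ * t) * B‖ := by
          gcongr
          exact norm_phase_sub_le hσ hz.le hz₁.le hg0 hg1 ht
      _ = 2 * ‖z - z₁‖ ^ g * (t ^ g * ‖A * prop (H0 d) (σ * t) * B‖) := by ring
      _ ≤ _ := by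
          gcongr
          exact hF t ht
  · rw [intervalIntegral.integral_const_mul]
    gcongr
    exact hK T hT

/-! ### From block bounds to weighted operators. -/

/-- Slice-wise bounds on `w X w` give bounds on `f X f` for `|f| ≤ |q₁ ⊗ q₂ ⊗ w|`. -/
theorem norm_mulBdd_mul_mulBdd_le {d : ℕ} {i₁ i₂ i₃ : Fin d} {w : ℤ → ℂ} (hw : ∀ k, ‖w k‖ ≤ 1)
    (X : Op d) {K : ℝ}
    (hX : ∀ k₁ k₂ l₁ l₂, ‖proj i₁ k₁ * proj i₂ k₂ * coordMul i₃ w * X *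
      (coordMul i₃ w * proj i₂ l₂ * proj i₁ l₁)‖ ≤ K)
    (q₁ q₂ : L2Z) (m : (Fin d → ℤ) → ℂ) (hm : ∀ n, ‖m n‖ ≤ 1) :
    ‖mulBdd (fun n => m n * (q₁ (n i₁) * (q₂ (n i₂) * w (n i₃)))) * X *
      mulBdd (fun n => m n * (q₁ (n i₁) * (q₂ (n i₂) * w (n i₃))))‖
      ≤ K * ‖q₁‖ ^ 2 * ‖q₂‖ ^ 2 := by
  have hq₁ := norm_coe_le q₁
  have hq₂ := norm_coe_le q₂
  have hI := norm_ind_le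
  have b1 : ∀ n : Fin d → ℤ, ‖q₂ (n i₂) * w (n i₃)‖ ≤ ‖q₂‖ * 1 := fun n =>
    norm_mul_le_of_le (hq₂ _) (hw _)
  have b2 : ∀ n : Fin d → ℤ, ‖q₁ (n i₁) * (q₂ (n i₂) * w (n i₃))‖ ≤ ‖q₁‖ * (‖q₂‖ * 1) :=
    fun n => norm_mul_le_of_le (hq₁ _) (b1 n)
  have hf : mulBdd (fun n => m n * (q₁ (n i₁) * (q₂ (n i₂) * w (n i₃))))
      = mulBdd m * (coordMul i₁ q₁ * (coordMul i₂ q₂ * coordMul i₃ w)) := by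
    rw [coordMul, coordMul, coordMul, mulBdd_mul (fun n => hq₂ (n i₂)) (fun n => hw (n i₃)),
      mulBdd_mul (fun n => hq₁ (n i₁)) b1, mulBdd_mul hm b2]
  have hf' : mulBdd (fun n => m n * (q₁ (n i₁) * (q₂ (n i₂) * w (n i₃))))
      -- The mirrored factorisation, used on the right so that `X` lies between two copies of `w`.
      = coordMul i₃ w * coordMul i₂ q₂ * coordMul i₁ q₁ * mulBdd m := by
    rw [hf, (commute_coordMul i₂ i₃ hq₂ hw).eq,
      ((commute_coordMul i₁ i₃ hq₁ hw).mul_right (commute_coordMul i₁ i₂ hq₁ hq₂)).eq]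
    refine Commute.eq (((Commute.mul_right ?_ ?_)).mul_right ?_)
    · exact commute_mulBdd hm fun n => hw (n i₃)
    · exact commute_mulBdd hm fun n => hq₂ (n i₂)
    · exact commute_mulBdd hm fun n => hq₁ (n i₁)
  -- The slicing argument is applied in coordinate `i₂` with the slices of `i₁` fixed, and
  -- afterwards in `i₁`.
  have h1 : ∀ k₁ l₁, ‖proj i₁ k₁ * (coordMul i₂ q₂ * (coordMul i₃ w * X * coordMul i₃ w) *
      coordMul i₂ q₂) * proj i₁ l₁‖ ≤ K * ‖q₂‖ ^ 2 := fun k₁ l₁ => by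
    have e1 : proj i₁ k₁ * (coordMul i₂ q₂ * (coordMul i₃ w * X * coordMul i₃ w) *
        coordMul i₂ q₂) * proj i₁ l₁ = coordMul i₂ q₂ *
          (proj i₁ k₁ * (coordMul i₃ w * X * coordMul i₃ w) * proj i₁ l₁) * coordMul i₂ q₂ := by
      have c1 : Commute (proj i₁ k₁) (coordMul i₂ q₂) := commute_coordMul _ _ (hI k₁) hq₂
      have c2 : Commute (coordMul i₂ q₂) (proj i₁ l₁) := commute_coordMul _ _ hq₂ (hI l₁)
      simp only [mul_assoc]
      rw [c1.left_comm, c2.eq]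
    rw [e1]
    refine norm_coordMul_mul_mul_le i₂ q₂ _ fun k₂ l₂ => ?_
    convert hX k₁ k₂ l₁ l₂ using 2
    have c1 : Commute (proj i₂ k₂) (proj i₁ k₁) := commute_coordMul _ _ (hI k₂) (hI k₁)
    have c2 : Commute (proj i₁ l₁) (proj i₂ l₂) := commute_coordMul _ _ (hI l₁) (hI l₂)
    simp only [mul_assoc]
    rw [c1.left_comm, c2.eq]
  have h2 := norm_coordMul_mul_mul_le i₁ q₁ _ h1
  have h3 : mulBdd (fun n => m n * (q₁ (n i₁) * (q₂ (n i₂) * w (n i₃)))) * X *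
      mulBdd (fun n => m n * (q₁ (n i₁) * (q₂ (n i₂) * w (n i₃))))
      = mulBdd m * (coordMul i₁ q₁ * (coordMul i₂ q₂ * (coordMul i₃ w * X * coordMul i₃ w) *
        coordMul i₂ q₂) * coordMul i₁ q₁) * mulBdd m := by
    nth_rewrite 2 [hf']
    rw [hf]
    simp only [mul_assoc]
  rw [h3]
  have h4 := norm_mulBdd_le hm
  refine (norm_mul_le_of_le (norm_mul_le_of_le h4 h2) h4).trans_eq (by ring)

/-- Half of the decay `s/32` makes the Bessel product integrable, and the other half pays for `t^g`.
The constant is uniform in the slices, in `z` and in the dimension. -/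
theorem exists_block_bounds {s : ℝ} (hs0 : 0 < s) (hs1 : s ≤ 1) :
    ∃ C, 0 ≤ C ∧ ∀ (d : ℕ) (i₁ i₂ i₃ : Fin d), i₁ ≠ i₂ → i₁ ≠ i₃ → i₂ ≠ i₃ →
      ∀ w : ℤ → ℂ, (∀ k, ‖w k‖ ≤ (1 + (k : ℝ) ^ 2) ^ (-s / 2)) → ∀ k₁ k₂ l₁ l₂ : ℤ,
      ∀ σ : ℝ, σ = 1 ∨ σ = -1 → ∀ z : ℂ, 0 < σ * z.im →
      ‖proj i₁ k₁ * proj i₂ k₂ * coordMul i₃ w * R0 d z *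
        (coordMul i₃ w * proj i₂ l₂ * proj i₁ l₁)‖ ≤ C ∧
      ∀ z₁ : ℂ, 0 < σ * z₁.im → ∀ g : ℝ, 0 ≤ g → g ≤ s / 64 →
        ‖proj i₁ k₁ * proj i₂ k₂ * coordMul i₃ w * (R0 d z - R0 d z₁) *
          (coordMul i₃ w * proj i₂ l₂ * proj i₁ l₁)‖ ≤ 2 * ‖z - z₁‖ ^ g * C := by
  obtain ⟨D, hD, hdec⟩ := exists_norm_weight_prop_weight_le hs0 hs1
  obtain ⟨B, hB, hint⟩ := exists_integral_norm_bes_mul_le (δ := s / 64) (by positivity)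
  refine ⟨D * B, by positivity, fun d i₁ i₂ i₃ h12 h13 h23 w hw k₁ k₂ l₁ l₂ σ hσ z hz => ?_⟩
  have hσ1 : |σ| = 1 := by rcases hσ with rfl | rfl <;> simp
  have hw1 : ∀ k, ‖w k‖ ≤ 1 := fun k => (hw k).trans
    (Real.rpow_le_one_of_one_le_of_nonpos (by linarith [sq_nonneg (k : ℝ)]) (by linarith))
  -- For `σ = -1`, reversing time amounts to changing the sign of the Bessel index.
  have hflip : ∀ a : ℤ, ∃ a' : ℤ, ∀ t, ‖bes a (σ * t)‖ = ‖bes a' t‖ := fun a => by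
    rcases hσ with rfl | rfl
    · exact ⟨a, fun t => by rw [one_mul]⟩
    · exact ⟨-a, fun t => by rw [neg_one_mul, norm_bes_neg]⟩
  obtain ⟨a, ha⟩ := hflip (k₁ - l₁)
  obtain ⟨b, hb⟩ := hflip (k₂ - l₂)
  set F : ℝ → ℝ := fun t => D * (‖bes a t‖ * ‖bes b t‖ * (1 + t) ^ (-(s / 64))) with hF
  have hFi : ∀ T, 0 ≤ T → IntervalIntegrable F volume 0 T := fun T hT =>
    ContinuousOn.intervalIntegrable (continuousOn_const.mul
      (((continuous_bes a).norm.mul (continuous_bes b).norm).continuousOn.mul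
        (continuousOn_one_add_rpow _ hT)))
  have hFK : ∀ T, 0 ≤ T → ∫ t in (0 : ℝ)..T, F t ≤ D * B := fun T hT => by
    rw [hF, intervalIntegral.integral_const_mul]
    gcongr
    exact hint a b T hT
  have hblock : ∀ t, 0 ≤ t → ‖proj i₁ k₁ * proj i₂ k₂ * coordMul i₃ w * prop (H0 d) (σ * t) *
      (coordMul i₃ w * proj i₂ l₂ * proj i₁ l₁)‖
      ≤ D * (‖bes a t‖ * ‖bes b t‖ * (1 + t) ^ (-(s / 32))) := fun t ht => by
    have h1 := norm_block_prop_le h12 h13 h23 hw1 (σ * t) k₁ k₂ l₁ l₂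
    have h2 := hdec d i₃ w hw (σ * t)
    rw [abs_mul, hσ1, one_mul, abs_of_nonneg ht] at h2
    rw [ha, hb] at h1
    have h3 : ∀ p w' e q p' : Op d, p * w' * e * (w' * q * p') = p * w' * e * w' * q * p' :=
      fun p w' e q p' => by simp only [mul_assoc]
    rw [h3]
    refine h1.trans ((mul_le_mul_of_nonneg_left h2 (by positivity)).trans_eq (by ring))
  have hpow : ∀ g : ℝ, 0 ≤ g → g ≤ s / 64 → ∀ t : ℝ, 0 ≤ t →
      t ^ g * (D * (‖bes a t‖ * ‖bes b t‖ * (1 + t) ^ (-(s / 32)))) ≤ F t :=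
    fun g hg0 hg1 t ht => by
      have h1 : t ^ g * (1 + t) ^ (-(s / 32)) ≤ (1 + t) ^ (-(s / 64)) := by
        calc t ^ g * (1 + t) ^ (-(s / 32)) ≤ (1 + t) ^ g * (1 + t) ^ (-(s / 32)) := by
              gcongr
              linarith
          _ = (1 + t) ^ (g + -(s / 32)) := (Real.rpow_add (by linarith) _ _).symm
          _ ≤ _ := Real.rpow_le_rpow_of_exponent_le (by linarith) (by linarith)
      calc _ = D * (‖bes a t‖ * ‖bes b t‖ * (t ^ g * (1 + t) ^ (-(s / 32)))) := by ring
        _ ≤ _ := by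
          change _ ≤ D * (‖bes a t‖ * ‖bes b t‖ * (1 + t) ^ (-(s / 64)))
          gcongr
  refine ⟨norm_mul_R0_mul_le hσ1 hz _ _ (fun t ht => ?_) hFi hFK, fun z₁ hz₁ g hg0 hg1 =>
    norm_mul_R0_sub_mul_le hσ1 hz hz₁ hg0 (by linarith) _ _ (fun t ht => ?_) hFi hFK⟩
  · refine (hblock t ht).trans ?_
    simpa using hpow 0 le_rfl (by positivity) t ht
  · exact (mul_le_mul_of_nonneg_left (hblock t ht) (by positivity)).trans (hpow g hg0 hg1 t ht)

/-! ### The weights of the theorem, and real spectral parameters. -/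

/-- The weight `(1 + k²)^(-s/2)` on `ℤ`. -/
noncomputable def weight (s : ℝ) (k : ℤ) : ℂ := (((1 + (k : ℝ) ^ 2) ^ (-s / 2) : ℝ) : ℂ)

theorem norm_weight (s : ℝ) (k : ℤ) : ‖weight s k‖ = (1 + (k : ℝ) ^ 2) ^ (-s / 2) := by
  rw [weight, Complex.norm_real, Real.norm_of_nonneg (by positivity)]

theorem weight_ne_zero (s : ℝ) (k : ℤ) : weight s k ≠ 0 := by
  rw [← norm_ne_zero_iff, norm_weight]
  positivity

/-- A radial weight is dominated by the weight in any one coordinate, so `ρ` can be traded for a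
function of `n₃` at the cost of a multiplier bounded by one. -/
theorem norm_rho_div_weight_le {s r : ℝ} (hs : 0 ≤ s) (hr : s ≤ r) {k : ℕ} (n : Fin k → ℤ)
    (i : Fin k) : ‖(rho r n : ℂ) / weight s (n i)‖ ≤ 1 := by
  rw [norm_div, norm_weight, Complex.norm_real, Real.norm_of_nonneg (rho_nonneg r n),
    div_le_one (by positivity), rho]
  have h1 : (n i : ℝ) ^ 2 ≤ ∑ j, (n j : ℝ) ^ 2 :=
    Finset.single_le_sum (f := fun j => (n j : ℝ) ^ 2) (fun _ _ => sq_nonneg _) (Finset.mem_univ i)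
  have h2 := sq_nonneg (n i : ℝ)
  calc (1 + ∑ j, (n j : ℝ) ^ 2) ^ (-r / 2) ≤ (1 + ∑ j, (n j : ℝ) ^ 2) ^ (-s / 2) :=
        Real.rpow_le_rpow_of_exponent_le (by linarith) (by linarith)
    _ ≤ _ := Real.rpow_le_rpow_of_nonpos (by linarith) (by linarith) (by linarith)

theorem Q_eq_mulBdd {d : ℕ} (hd : 3 ≤ d) {s : ℝ} (hs : 0 ≤ s) (q₁ q₂ : L2Z) :
    Q hd hs q₁ q₂ = mulBdd fun n =>
      (rho s (fun j : Fin (d - 2) => n ⟨j + 2, by omega⟩) : ℂ) / weight s (n ⟨2, by omega⟩) *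
        (q₁ (n ⟨0, by omega⟩) * (q₂ (n ⟨1, by omega⟩) * weight s (n ⟨2, by omega⟩))) := by
  rw [Q, mulOp_eq_mulBdd]
  congr 1
  funext n
  have h := weight_ne_zero s (n ⟨2, by omega⟩)
  rw [Qfun]
  field_simp

theorem Qg_eq_mulBdd {d : ℕ} (hd : 3 ≤ d) {s g : ℝ} (hs : 0 ≤ s) (hg : 0 ≤ g) (q₁ q₂ : L2Z) :
    Qg hd hs hg q₁ q₂ = mulBdd fun n =>
      (rho g (fun _ : Fin 1 => n ⟨0, by omega⟩) : ℂ) *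
        ((rho (s + 2 * g) (fun j : Fin (d - 2) => n ⟨j + 2, by omega⟩) : ℂ) /
          weight s (n ⟨2, by omega⟩)) *
        (q₁ (n ⟨0, by omega⟩) * (q₂ (n ⟨1, by omega⟩) * weight s (n ⟨2, by omega⟩))) := by
  rw [Qg, mulOp_eq_mulBdd]
  congr 1
  funext n
  have h := weight_ne_zero s (n ⟨2, by omega⟩)
  rw [Qgfun, Qfun]
  field_simp

theorem continuousAt_R0 {d : ℕ} {z : ℂ} (hz : z ∈ Lam d) : ContinuousAt (R0 d) z := by
  obtain ⟨u, hu⟩ := isUnit_H0_sub hz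
  have h1 := NormedRing.inverse_continuousAt u
  rw [hu] at h1
  have h2 : ContinuousAt (fun z : ℂ => H0 d - z • ContinuousLinearMap.id ℂ (L2Zd d)) z := by
    fun_prop
  exact ContinuousAt.comp (g := Ring.inverse) h1 h2

/-- A real point of the resolvent set is approached from the upper half-plane, where the bound is
uniform. -/
theorem norm_mul_R0_mul_le_of_im_ne_zero {d : ℕ} {A B : Op d} {K : ℝ}
    (h : ∀ z : ℂ, z.im ≠ 0 → ‖A * R0 d z * B‖ ≤ K) {z : ℂ} (hz : z ∈ Lam d) :
    ‖A * R0 d z * B‖ ≤ K := by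
  by_cases him : z.im = 0
  · have h1 : Tendsto (fun e : ℝ => z + e * Complex.I) (𝓝[>] 0) (𝓝 z) := by
      have h2 : Continuous fun e : ℝ => z + e * Complex.I := by fun_prop
      have h3 := h2.tendsto 0
      simp only [Complex.ofReal_zero, zero_mul, add_zero] at h3
      exact h3.mono_left nhdsWithin_le_nhds
    have h4 := (((continuousAt_R0 hz).tendsto.comp h1).const_mul A).mul_const B
    refine le_of_tendsto h4.norm (eventually_mem_nhdsWithin.mono fun e he => h _ ?_)
    simpa [him] using (ne_of_gt he : e ≠ 0)
  · exact h z him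

end FreeLattice

theorem lemma5p5 (d : ℕ) (hd : 3 ≤ d) (s : ℝ) (hs0 : 0 < s) (hs1 : s ≤ 1) :
    -- the resolvent exists off `[0, d]`
    (∀ z ∈ Lam d, IsUnit (H0 d - z • ContinuousLinearMap.id ℂ (L2Zd d))) ∧
    -- uniform bound
    (∃ C : ℝ, 0 < C ∧ ∀ q₁ q₂ : L2Z, ∀ z ∈ Lam d, ‖z‖ < 2 * d →
      ‖Q hd hs0.le q₁ q₂ ∘L R0 d z ∘L Q hd hs0.le q₁ q₂‖ ≤ C * ‖q₁‖ ^ 2 * ‖q₂‖ ^ 2) ∧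
    -- Hölder estimate for all sufficiently small exponents `g`
    (∃ g₀ : ℝ, 0 < g₀ ∧ ∀ (g : ℝ) (hg : 0 < g), g < g₀ →
      ∃ C : ℝ, 0 < C ∧ ∀ q₁ q₂ : L2Z, ∀ z z₁ : ℂ,
        ((0 < z.im ∧ 0 < z₁.im) ∨ (z.im < 0 ∧ z₁.im < 0)) →
        ‖z‖ < 2 * d → ‖z₁‖ < 2 * d →
        ‖Qg hd hs0.le hg.le q₁ q₂ ∘L (R0 d z - R0 d z₁) ∘L Qg hd hs0.le hg.le q₁ q₂‖
          ≤ ‖z - z₁‖ ^ g * C * ‖q₁‖ ^ 2 * ‖q₂‖ ^ 2) := by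
  obtain ⟨C, hC, hblock⟩ := exists_block_bounds hs0 hs1
  have hb := hblock d ⟨0, by omega⟩ ⟨1, by omega⟩ ⟨2, by omega⟩ (by simp) (by simp) (by simp)
    (weight s) fun k => (norm_weight s k).le
  have hw1 : ∀ k, ‖weight s k‖ ≤ 1 := fun k => (norm_weight s k).trans_le
    (Real.rpow_le_one_of_one_le_of_nonpos (by linarith [sq_nonneg (k : ℝ)]) (by linarith))
  -- Adding one makes the constants positive, as `C` is only known to be nonnegative.
  refine ⟨fun z hz => isUnit_H0_sub hz, ⟨C + 1, by positivity, fun q₁ q₂ z hz _ => ?_⟩,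
    s / 64, by positivity, fun g hg hg1 => ⟨2 * C + 1, by positivity,
      fun q₁ q₂ z z₁ him _ _ => ?_⟩⟩
  · have h1 : ‖Q hd hs0.le q₁ q₂ * R0 d z * Q hd hs0.le q₁ q₂‖ ≤ C * ‖q₁‖ ^ 2 * ‖q₂‖ ^ 2 := by
      refine norm_mul_R0_mul_le_of_im_ne_zero (fun z hz => ?_) hz
      rw [Q_eq_mulBdd]
      refine norm_mulBdd_mul_mulBdd_le hw1 _ (fun k₁ k₂ l₁ l₂ => ?_) q₁ q₂ _ fun n =>
        norm_rho_div_weight_le hs0.le le_rfl _ (⟨0, by omega⟩ : Fin (d - 2))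
      rcases lt_or_gt_of_ne hz with h | h
      · exact (hb k₁ k₂ l₁ l₂ (-1) (Or.inr rfl) z (by linarith)).1
      · exact (hb k₁ k₂ l₁ l₂ 1 (Or.inl rfl) z (by linarith)).1
    rw [mul_assoc] at h1
    refine h1.trans ?_
    gcongr
    linarith
  · have h1 : ‖Qg hd hs0.le hg.le q₁ q₂ * (R0 d z - R0 d z₁) * Qg hd hs0.le hg.le q₁ q₂‖
        ≤ 2 * ‖z - z₁‖ ^ g * C * ‖q₁‖ ^ 2 * ‖q₂‖ ^ 2 := by
      rw [Qg_eq_mulBdd]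
      refine norm_mulBdd_mul_mulBdd_le hw1 _ (fun k₁ k₂ l₁ l₂ => ?_) q₁ q₂ _ fun n => ?_
      · rcases him with h | h
        · exact (hb k₁ k₂ l₁ l₂ 1 (Or.inl rfl) z (by linarith)).2 z₁ (by linarith) g hg.le hg1.le
        · exact (hb k₁ k₂ l₁ l₂ (-1) (Or.inr rfl) z (by linarith)).2 z₁ (by linarith) g hg.le
            hg1.le
      -- The weight `ρ_g(n₁)` and the extra exponent `2g` enter only through a bounded multiplier;
      -- the power `t^g` is already paid for by the third coordinate.
      · rw [norm_mul, Complex.norm_real, Real.norm_of_nonneg (rho_nonneg _ _)]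
        exact mul_le_one₀ (rho_le_one hg.le _) (norm_nonneg _)
          (norm_rho_div_weight_le hs0.le (by linarith) _ (⟨0, by omega⟩ : Fin (d - 2)))
    rw [mul_assoc] at h1
    refine h1.trans ?_
    have h2 : 2 * ‖z - z₁‖ ^ g * C = ‖z - z₁‖ ^ g * (2 * C) := by ring
    rw [h2]
    gcongr
    linarith
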